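/- Let $n\ge 0$ and let $\mathfrak S_n$ be the set of permutations of $[n]=\{1,\dots,n\}$. *Cyclic statistics.* For $\sigma\in\mathfrak S_n$ let $\mathrm{drop}\,\sigma=\#\{i:\ i>\sigma(i)\}$, and call $x\in[n]$ a *cyclic valley* if $\sigma^{-1}(x)>x<\sigma(x)$, a *(cyclic) double excedance* if $\sigma^{-1}(x)<x<\sigma(x)$, a *(cyclic) double drop* if $\sigma^{-1}(x)>x>\sigma(x)$, and a *fixed point* if $\sigma(x)=x$; let $\mathrm{cvalley}\,\sigma,\ \mathrm{cda}\,\sigma,\ \mathrm{cdd}\,\sigma,\ \mathrm{fix}\,\sigma$ be their numbers. Let $\mathrm{cros}\,\sigma$ be the number of $(i,j)\in[n]^2$ with $i<j\le\sigma(i)<\sigma(j)$ or $i>j>\sigma(i)>\sigma(j)$, and $\mathrm{nest}\,\sigma$ the number of $(i,j)\in[n]^2$ with $i<j\le\sigma(j)<\sigma(i)$ or $i>j>\sigma(j)>\sigma(i)$. *Linear statistics.* With the convention $\sigma(0)=0$, $\sigma(n+1)=n+1$, the entry $\sigma(i)$ $(i\in[n])$ is a *valley* if $\sigma(i-1)>\sigma(i)<\sigma(i+1)$,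 and a *double ascent* if $\sigma(i-1)<\sigma(i)<\sigma(i+1)$; a double ascent $\sigma(i)$ is a *foremaximum* if $\sigma(j)<\sigma(i)$ for all $1\le j<i$. Let $(31\text{-}2)\sigma$ be the number of pairs $2\le i<j\le n$ with $\sigma(i-1)>\sigma(j)>\sigma(i)$, and $(2\text{-}31)\sigma$ the number of pairs $1\le i<j\le n-1$ with $\sigma(j+1)<\sigma(i)<\sigma(j)$. Let $$B_n(p,q,t,u,v,w,y)=\sum_{\sigma\in\mathfrak S_n}p^{\mathrm{nest}\,\sigma}q^{\mathrm{cros}\,\sigma}t^{\mathrm{drop}\,\sigma}u^{\mathrm{cda}\,\sigma}v^{\mathrm{cdd}\,\sigma}w^{\mathrm{cvalley}\,\sigma}y^{\mathrm{fix}\,\sigma},$$ and define $b_{n,k,j}(p,q)\in\mathbb Z[p,q]$ as the coefficient of $w^ky^j$ in $B_n(p,q,1,0,1,w,y)$. Then for all $n,k,j\ge0$ $$b_{n,k,j}(p,q)=\sum_{\sigma\in\mathfrak S_{n,k,j}}p^{\mathrm{nest}\,\sigma}q^{\mathrm{cros}\,\sigma}=\sum_{\sigma\in\mathfrak S^*_{n,k,j}}p^{(2\text{-}31)\sigma}q^{(31\text{-}2)\sigma},$$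 where $\mathfrak S_{n,k,j}$ is the set of $\sigma\in\mathfrak S_n$ with exactly $k$ cyclic valleys, exactly $j$ fixed points and no double excedance, and $\mathfrak S^*_{n,k,j}$ is the set of $\sigma\in\mathfrak S_n$ with exactly $k$ valleys and exactly $j$ double ascents, all of which are foremaxima. In particular, $$b_{n,k,0}(p,q)=\sum_{\sigma\in\mathfrak D_{n,k,0}}p^{\mathrm{nest}\,\sigma}q^{\mathrm{cros}\,\sigma}=\sum_{\sigma\in\mathfrak D^*_{n,k,0}}p^{(2\text{-}31)\sigma}q^{(31\text{-}2)\sigma},$$ where $\mathfrak D_{n,k,0}$ is the set of derangements of $[n]$ with exactly $k$ cyclic valleys and no double excedance, and $\mathfrak D^*_{n,k,0}$ is the set of coderangements of $[n]$ (permutations without foremaximum) with exactly $k$ valleys and no double ascent. -/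

import Mathlib

namespace PermStat

open Finset

/-! Permutations of `[n]` are elements of `Equiv.Perm (Fin n)`; the letter `i ∈ [n]` is the
element of `Fin n` with value `i - 1`. The cyclic statistics only compare letters, so they are
stated directly on `Fin n`. The linear statistics use the word `σ(0) σ(1) … σ(n) σ(n+1)`
with one-based positions and letters. -/

section Cyclic

variable {n : ℕ}

/-- The number of drops: `i` with `i > σ(i)`. -/
def drops (σ : Equiv.Perm (Fin n)) : ℕ := #{i : Fin n | σ i < i}

/-- The number of cyclic valleys: `x` with `σ⁻¹(x) > x` and `x < σ(x)`. -/
def cvalley (σ : Equiv.Perm (Fin n)) : ℕ := #{x : Fin n | x < σ⁻¹ x ∧ x < σ x}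

/-- The number of (cyclic) double excedances: `x` with `σ⁻¹(x) < x` and `x < σ(x)`. -/
def cda (σ : Equiv.Perm (Fin n)) : ℕ := #{x : Fin n | σ⁻¹ x < x ∧ x < σ x}

/-- The number of (cyclic) double drops: `x` with `σ⁻¹(x) > x` and `x > σ(x)`. -/
def cdd (σ : Equiv.Perm (Fin n)) : ℕ := #{x : Fin n | x < σ⁻¹ x ∧ σ x < x}

/-- The number of fixed points. -/
def fix (σ : Equiv.Perm (Fin n)) : ℕ := #{x : Fin n | σ x = x}

/-- The number of crossings. -/
def cros (σ : Equiv.Perm (Fin n)) : ℕ :=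
  #{ij : Fin n × Fin n |
    (ij.1 < ij.2 ∧ ij.2 ≤ σ ij.1 ∧ σ ij.1 < σ ij.2) ∨
    (ij.1 > ij.2 ∧ ij.2 > σ ij.1 ∧ σ ij.1 > σ ij.2)}

/-- The number of nestings. -/
def nest (σ : Equiv.Perm (Fin n)) : ℕ :=
  #{ij : Fin n × Fin n |
    (ij.1 < ij.2 ∧ ij.2 ≤ σ ij.2 ∧ σ ij.2 < σ ij.1) ∨
    (ij.1 > ij.2 ∧ ij.2 > σ ij.2 ∧ σ ij.2 > σ ij.1)}

end Cyclic

section Linear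

variable {n : ℕ}

/-- The one-based word of `σ`: `word σ i = σ(i) ∈ {1, …, n}` for `1 ≤ i ≤ n`, with the boundary
convention `σ(0) = 0` and `σ(n+1) = n+1` (arguments beyond `n + 1` are never used). -/
def word (σ : Equiv.Perm (Fin n)) (i : ℕ) : ℕ :=
  if h : 1 ≤ i ∧ i ≤ n then (σ ⟨i - 1, by omega⟩ : ℕ) + 1 else i

/-- The entry at position `i` is a valley: `σ(i-1) > σ(i) < σ(i+1)`. -/
def IsValley (σ : Equiv.Perm (Fin n)) (i : ℕ) : Prop :=
  word σ (i - 1) > word σ i ∧ word σ i < word σ (i + 1)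

instance (σ : Equiv.Perm (Fin n)) : DecidablePred (IsValley σ) :=
  fun i => by unfold IsValley; infer_instance

/-- The entry at position `i` is a double ascent: `σ(i-1) < σ(i) < σ(i+1)`. -/
def IsDoubleAscent (σ : Equiv.Perm (Fin n)) (i : ℕ) : Prop :=
  word σ (i - 1) < word σ i ∧ word σ i < word σ (i + 1)

instance (σ : Equiv.Perm (Fin n)) : DecidablePred (IsDoubleAscent σ) :=
  fun i => by unfold IsDoubleAscent; infer_instance

/-- The entry at position `i` is a foremaximum: a double ascent that is a left-to-right
maximum. -/
def IsForemax (σ : Equiv.Perm (Fin n)) (i : ℕ) : Prop :=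
  IsDoubleAscent σ i ∧ ∀ j ∈ Ico 1 i, word σ j < word σ i

instance (σ : Equiv.Perm (Fin n)) : DecidablePred (IsForemax σ) :=
  fun i => by unfold IsForemax; infer_instance

/-- The number of valleys. -/
def valley (σ : Equiv.Perm (Fin n)) : ℕ := #{i ∈ Icc 1 n | IsValley σ i}

/-- The number of double ascents. -/
def da (σ : Equiv.Perm (Fin n)) : ℕ := #{i ∈ Icc 1 n | IsDoubleAscent σ i}

/-- The number of foremaxima. -/
def fmax (σ : Equiv.Perm (Fin n)) : ℕ := #{i ∈ Icc 1 n | IsForemax σ i}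

/-- The statistic (31-2): the number of pairs `2 ≤ i < j ≤ n` with `σ(i-1) > σ(j) > σ(i)`. -/
def pat31_2 (σ : Equiv.Perm (Fin n)) : ℕ :=
  #{ij ∈ Icc 1 n ×ˢ Icc 1 n |
    (2 ≤ ij.1 ∧ ij.1 < ij.2) ∧
    word σ (ij.1 - 1) > word σ ij.2 ∧ word σ ij.2 > word σ ij.1}

/-- The statistic (2-31): the number of pairs `1 ≤ i < j ≤ n - 1` with
`σ(j+1) < σ(i) < σ(j)`. -/
def pat2_31 (σ : Equiv.Perm (Fin n)) : ℕ :=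
  #{ij ∈ Icc 1 n ×ˢ Icc 1 n |
    (ij.1 < ij.2 ∧ ij.2 < n) ∧
    word σ (ij.2 + 1) < word σ ij.1 ∧ word σ ij.1 < word σ ij.2}

end Linear

/-- The polynomial `B_n(p,q,t,u,v,w,y)`, evaluated at elements of a commutative semiring. -/
def B {R : Type*} [CommSemiring R] (n : ℕ) (p q t u v w y : R) : R :=
  ∑ σ : Equiv.Perm (Fin n),
    p ^ nest σ * q ^ cros σ * t ^ drops σ * u ^ cda σ * v ^ cdd σ * w ^ cvalley σ * y ^ fix σ

/-- The variable `p` of `ℤ[p,q]`. -/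
noncomputable def pVar : MvPolynomial (Fin 2) ℤ := MvPolynomial.X 0

/-- The variable `q` of `ℤ[p,q]`. -/
noncomputable def qVar : MvPolynomial (Fin 2) ℤ := MvPolynomial.X 1

/-- `b_{n,k,j}(p,q) ∈ ℤ[p,q]`: the coefficient of `w^k y^j` in `B_n(p,q,1,0,1,w,y)`, which is
viewed as an element of `ℤ[p,q][w][y]`. -/
noncomputable def b (n k j : ℕ) : MvPolynomial (Fin 2) ℤ :=
  ((B n (Polynomial.C (Polynomial.C pVar)) (Polynomial.C (Polynomial.C qVar)) 1 0 1
      (Polynomial.C Polynomial.X) Polynomial.X :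
    Polynomial (Polynomial (MvPolynomial (Fin 2) ℤ))).coeff j).coeff k

/-- Permutations of `[n]` with exactly `k` cyclic valleys, exactly `j` fixed points and no
double excedance. -/
def S (n k j : ℕ) : Finset (Equiv.Perm (Fin n)) :=
  {σ | cvalley σ = k ∧ fix σ = j ∧ cda σ = 0}

/-- Permutations of `[n]` with exactly `k` valleys and exactly `j` double ascents, all of which
are foremaxima. -/
def SStar (n k j : ℕ) : Finset (Equiv.Perm (Fin n)) :=
  {σ | valley σ = k ∧ da σ = j ∧ ∀ i ∈ {i ∈ Icc 1 n | IsDoubleAscent σ i}, IsForemax σ i}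

/-- Derangements of `[n]` with exactly `k` cyclic valleys and no double excedance. -/
def D (n k : ℕ) : Finset (Equiv.Perm (Fin n)) :=
  {σ | (∀ x, σ x ≠ x) ∧ cvalley σ = k ∧ cda σ = 0}

/-- Coderangements of `[n]` (permutations without foremaximum) with exactly `k` valleys and no
double ascent. -/
def DStar (n k : ℕ) : Finset (Equiv.Perm (Fin n)) :=
  {σ | fmax σ = 0 ∧ valley σ = k ∧ da σ = 0}

end PermStat

namespace PermStat

open Finset

/-! ### Two weightings of Motzkin paths -/

section Algebra

variable {R : Type*} [CommSemiring R]

/-! Both sums are computed by admitting the letters of a permutation in increasing order. Each then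
becomes a weighted count of Motzkin paths of length `n` from height 0 to height 0. Write `[h]` for
`pqNat p q h`.

Cyclic side: after the letters `< m`, the state is the partial injection they induce. Its height `h`
is the number of sources, and also of targets, whose partner is still to come. A cyclic valley opens
one of each (weight `w`). A fixed point lies under the `h` open upper arcs (weight `y p^h`). A
double drop closes one of `h` targets (`[h]`), a cyclic peak closes a target and a source (`[h]^2`),
and double excedances have weight 0. This is `sum_arcClass`.

Linear side: the state is the relative order of the letters `< m` in the word, together with the set
of those letters whose left neighbour is still to come. These are the starts of maximal blocks of
small letters, except for a block at the beginning of the word; `h` is their number. A new letter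
goes in front of a block start or after all smaller letters, may or may not be glued to what
follows, and may or may not start a block. Summing over the places gives up weight `w [h+1]`, level
weight `[h] + y p^h` and down weight `[h]`. This is `sum_blockClass`.

The level weights agree, and an up step from `h` followed by its matching down step has weight `w
[h+1]^2` in both models. The path counts from height 0 therefore coincide
(`cycPaths_zero_eq_linPaths_zero`), and comparing coefficients of `w^k y^j` finishes the proof. -/

/-- The `(p,q)`-analogue of the natural number `h`. -/
def pqNat (p q : R) (h : ℕ) : R := ∑ i ∈ range h, q ^ i * p ^ (h - 1 - i)

lemma pqNat_zero (p q : R) : pqNat p q 0 = 0 := by simp [pqNat]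

lemma pqNat_succ (p q : R) (h : ℕ) : pqNat p q (h + 1) = p * pqNat p q h + q ^ h := by
  unfold pqNat
  rw [sum_range_succ, mul_sum]
  congr 1
  · refine sum_congr rfl fun i hi => ?_
    have hi := mem_range.1 hi
    rw [show h + 1 - 1 - i = (h - 1 - i) + 1 by omega, pow_succ]
    ring
  · simp

/-- Weighted count of Motzkin paths of length `r` from height `h` to height `0`: an up step has
weight `w`, a level step `[h] + y p ^ h`, a down step `[h] ^ 2`. -/
def cycPaths (p q w y : R) : ℕ → ℕ → R
  | 0, h => if h = 0 then 1 else 0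
  | r + 1, h => w * cycPaths p q w y r (h + 1) +
      (pqNat p q h + y * p ^ h) * cycPaths p q w y r h +
      pqNat p q h ^ 2 * cycPaths p q w y r (h - 1)

/-- Weighted count of Motzkin paths of length `r` from height `h` to height `0`: an up step has
weight `w [h + 1]`, a level step `[h] + y p ^ h`, a down step `[h]`. -/
def linPaths (p q w y : R) : ℕ → ℕ → R
  | 0, h => if h = 0 then 1 else 0
  | r + 1, h => w * pqNat p q (h + 1) * linPaths p q w y r (h + 1) +
      (pqNat p q h + y * p ^ h) * linPaths p q w y r h +
      pqNat p q h * linPaths p q w y r (h - 1)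

/-- A diagonal change of basis: scaling height `h` by `[1]⋯[h]` moves one factor `[h+1]` from each
down step to the matching up step. The truncated `h - 1` at height 0 is harmless because `[0] = 0`.
-/
lemma cycPaths_eq_prod_mul_linPaths (p q w y : R) (r h : ℕ) :
    cycPaths p q w y r h = (∏ i ∈ range h, pqNat p q (i + 1)) * linPaths p q w y r h := by
  induction r generalizing h with
  | zero => rcases h with _ | h <;> simp [cycPaths, linPaths]
  | succ r ih =>
    simp only [cycPaths, linPaths, ih]
    rcases h with _ | h
    · simp [pqNat_zero]
      ring
    · simp only [prod_range_succ, Nat.add_sub_cancel]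
      ring

lemma cycPaths_zero_eq_linPaths_zero (p q w y : R) (r : ℕ) :
    cycPaths p q w y r 0 = linPaths p q w y r 0 := by
  simp [cycPaths_eq_prod_mul_linPaths]

end Algebra

/-! ### Ranks in a finite total order -/

section Rank

variable {α : Type*} [DecidableEq α]

/-- The number of predecessors runs through `0, …, #s - 1` along a strict total order on `s`. -/
lemma sum_card_pred {M : Type*} [AddCommMonoid M] (s : Finset α) (r : α → α → Prop)
    [DecidableRel r] (irr : ∀ a ∈ s, ¬ r a a)
    (trans : ∀ a ∈ s, ∀ b ∈ s, ∀ c ∈ s, r a b → r b c → r a c)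
    (tot : ∀ a ∈ s, ∀ b ∈ s, a ≠ b → r a b ∨ r b a) (F : ℕ → M) :
    ∑ y ∈ s, F #{a ∈ s | r a y} = ∑ i ∈ range #s, F i := by
  have hlt : ∀ a ∈ s, ∀ b ∈ s, r a b → #{c ∈ s | r c a} < #{c ∈ s | r c b} := by
    intro a ha b hb hab
    refine card_lt_card ((ssubset_iff_of_subset ?_).2 ⟨a, ?_, ?_⟩)
    · intro c hc
      simp only [mem_filter] at hc ⊢
      exact ⟨hc.1, trans c hc.1 a ha b hb hc.2 hab⟩
    · simp [ha, hab]
    · simp [irr a ha]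
  have hinj : Set.InjOn (fun y => #{a ∈ s | r a y}) s := by
    intro a ha b hb hab
    by_contra hne
    rcases tot a ha b hb hne with h | h
    · exact absurd hab (hlt a ha b hb h).ne
    · exact absurd hab (hlt b hb a ha h).ne'
  -- The predecessor count is injective with values below `#s`, so it takes every such value exactly
  -- once.
  have himg : s.image (fun y => #{a ∈ s | r a y}) = range #s := by
    refine eq_of_subset_of_card_le ?_ ?_
    · intro i hi
      obtain ⟨y, hy, rfl⟩ := mem_image.1 hi
      refine mem_range.2 (card_lt_card ((ssubset_iff_of_subset (filter_subset _ _)).2 ⟨y, hy, ?_⟩))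
      simp [irr y hy]
    · rw [card_range, card_image_of_injOn hinj]
  rw [← himg, sum_image hinj]

lemma card_succ_eq (s : Finset α) (r : α → α → Prop) [DecidableRel r]
    (irr : ∀ a ∈ s, ¬ r a a)
    (trans : ∀ a ∈ s, ∀ b ∈ s, ∀ c ∈ s, r a b → r b c → r a c)
    (tot : ∀ a ∈ s, ∀ b ∈ s, a ≠ b → r a b ∨ r b a) {y : α} (hy : y ∈ s) :
    #{a ∈ s | r y a} = #s - 1 - #{a ∈ s | r a y} := by
  have h : #{a ∈ s | r y a} + #{a ∈ s | r a y} = #(s.erase y) := by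
    rw [← card_union_of_disjoint]
    · congr 1
      ext a
      simp only [mem_union, mem_filter, mem_erase]
      constructor
      · rintro (⟨h1, h2⟩ | ⟨h1, h2⟩)
        · exact ⟨fun h => irr y hy (h ▸ h2), h1⟩
        · exact ⟨fun h => irr y hy (h ▸ h2), h1⟩
      · rintro ⟨h1, h2⟩
        rcases tot a h2 y hy h1 with h | h
        · exact Or.inr ⟨h2, h⟩
        · exact Or.inl ⟨h2, h⟩
    · rw [disjoint_left]
      intro a h1 h2
      simp only [mem_filter] at h1 h2
      exact irr y hy (trans y hy a h1.1 y hy h1.2 h2.2)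
  rw [card_erase_of_mem hy] at h
  omega

/-- Summing `q ^ #predecessors * p ^ #successors` gives the `(p,q)`-analogue of `#s`. -/
lemma sum_pow_pred_mul_pow_succ {R : Type*} [CommSemiring R] (p q : R) (s : Finset α)
    (r : α → α → Prop) [DecidableRel r] (irr : ∀ a ∈ s, ¬ r a a)
    (trans : ∀ a ∈ s, ∀ b ∈ s, ∀ c ∈ s, r a b → r b c → r a c)
    (tot : ∀ a ∈ s, ∀ b ∈ s, a ≠ b → r a b ∨ r b a) :
    ∑ y ∈ s, q ^ #{a ∈ s | r a y} * p ^ #{a ∈ s | r y a} = pqNat p q #s := by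
  rw [pqNat, ← sum_card_pred s r irr trans tot (fun i => q ^ i * p ^ (#s - 1 - i))]
  refine sum_congr rfl fun y hy => ?_
  rw [card_succ_eq s r irr trans tot hy]

end Rank

end PermStat

namespace PermStat

open Finset

/-! ### Cyclic statistics letter by letter -/

section CyclicSide

variable {n : ℕ}

/-- The number of nestings whose inner arc is closed by the letter `x`. -/
def nestAt (σ : Equiv.Perm (Fin n)) (x : Fin n) : ℕ :=
  #{i | i < σ.symm x ∧ σ.symm x ≤ x ∧ x < σ i} + #{z | z < σ x ∧ σ x < x ∧ x < σ.symm z}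

/-- The number of crossings whose first closed arc is closed by the letter `x`. -/
def crosAt (σ : Equiv.Perm (Fin n)) (x : Fin n) : ℕ :=
  #{j | σ.symm x < j ∧ j ≤ x ∧ x < σ j} + #{z | σ x < z ∧ z < x ∧ x < σ.symm z}

lemma card_pairs_eq_sum (P : Fin n → Fin n → Prop) [∀ i j, Decidable (P i j)] :
    #{ij : Fin n × Fin n | P ij.1 ij.2} = ∑ j, #{i | P i j} := by
  simp only [card_filter]
  rw [Fintype.sum_prod_type_right]

lemma card_pairs_eq_sum' (P : Fin n → Fin n → Prop) [∀ i j, Decidable (P i j)] :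
    #{ij : Fin n × Fin n | P ij.1 ij.2} = ∑ i, #{j | P i j} := by
  simp only [card_filter]
  rw [Fintype.sum_prod_type]

/-- An arc is closed by its larger end: the target for an upper arc `i ≤ σ i`, the source for a
lower arc. Hence the first half is reindexed by `σ.symm`, while in the second half only the outer
arc is renamed, by its target. -/
lemma nest_eq_sum (σ : Equiv.Perm (Fin n)) : nest σ = ∑ x, nestAt σ x := by
  unfold nest nestAt
  rw [filter_or, card_union_of_disjoint, sum_add_distrib]
  · congr 1
    · rw [card_pairs_eq_sum fun i j => i < j ∧ j ≤ σ j ∧ σ j < σ i, ← Equiv.sum_comp σ.symm]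
      simp
    · rw [card_pairs_eq_sum fun i j => i > j ∧ j > σ j ∧ σ j > σ i]
      refine sum_congr rfl fun j _ => ?_
      refine card_bij (fun i _ => σ i) ?_ ?_ ?_
      · intro i; simp; tauto
      · intro i _ i' _ h; exact σ.injective h
      · intro z hz
        refine ⟨σ.symm z, ?_, by simp⟩
        simp at hz ⊢; tauto
  · rw [disjoint_left]
    rintro ⟨i, j⟩ h1 h2
    simp only [mem_filter, mem_univ, true_and] at h1 h2
    exact lt_asymm h1.1 h2.1

lemma cros_eq_sum (σ : Equiv.Perm (Fin n)) : cros σ = ∑ x, crosAt σ x := by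
  unfold cros crosAt
  rw [filter_or, card_union_of_disjoint, sum_add_distrib]
  · congr 1
    · rw [card_pairs_eq_sum' fun i j => i < j ∧ j ≤ σ i ∧ σ i < σ j, ← Equiv.sum_comp σ.symm]
      simp
    · rw [card_pairs_eq_sum fun i j => i > j ∧ j > σ i ∧ σ i > σ j]
      refine sum_congr rfl fun j _ => ?_
      refine card_bij (fun i _ => σ i) ?_ ?_ ?_
      · intro i; simp; tauto
      · intro i _ i' _ h; exact σ.injective h
      · intro z hz
        refine ⟨σ.symm z, ?_, by simp⟩
        simp at hz ⊢; tauto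
  · rw [disjoint_left]
    rintro ⟨i, j⟩ h1 h2
    simp only [mem_filter, mem_univ, true_and] at h1 h2
    exact lt_asymm h1.1 h2.1

variable {R : Type*} [CommSemiring R]

/-- The contribution of the letter `x` to the cyclic weight of `σ`. -/
def cycWt (p q w y : R) (σ : Equiv.Perm (Fin n)) (x : Fin n) : R :=
  p ^ nestAt σ x * q ^ crosAt σ x * (if σ.symm x < x ∧ x < σ x then 0 else 1) *
    (if x < σ.symm x ∧ x < σ x then w else 1) * (if σ x = x then y else 1)

lemma B_eq_sum_prod_cycWt (p q w y : R) :
    B n p q 1 0 1 w y = ∑ σ : Equiv.Perm (Fin n), ∏ x, cycWt p q w y σ x := by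
  unfold B
  refine sum_congr rfl fun σ _ => ?_
  simp only [cycWt, prod_mul_distrib, prod_pow_eq_pow_sum, nest_eq_sum, cros_eq_sum, prod_ite,
    prod_const, one_pow, mul_one, cda, cvalley, fix, Equiv.Perm.inv_def]

/-- The sources `< m` of no arc of `E`. -/
def freeSrc (m : ℕ) (E : Finset (Fin n × Fin n)) : Finset (Fin n) :=
  {a | a.val < m ∧ ∀ b, (a, b) ∉ E}

/-- The targets `< m` of no arc of `E`. -/
def freeTgt (m : ℕ) (E : Finset (Fin n × Fin n)) : Finset (Fin n) :=
  {b | b.val < m ∧ ∀ a, (a, b) ∉ E}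

/-- `E` is the graph of a partial injection of the letters `< m` with `h` free sources and `h` free
targets. -/
structure IsPartialInj (m h : ℕ) (E : Finset (Fin n × Fin n)) : Prop where
  lt : ∀ a b, (a, b) ∈ E → a.val < m ∧ b.val < m
  fn : ∀ a b c, (a, b) ∈ E → (a, c) ∈ E → b = c
  inj : ∀ a b c, (a, c) ∈ E → (b, c) ∈ E → a = b
  card_src : #(freeSrc m E) = h
  card_tgt : #(freeTgt m E) = h

/-- The permutations whose arcs between letters `< m` are those of `E`. -/
def arcClass (m : ℕ) (E : Finset (Fin n × Fin n)) : Finset (Equiv.Perm (Fin n)) :=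
  {σ | ∀ a b : Fin n, a.val < m → b.val < m → (σ a = b ↔ (a, b) ∈ E)}

lemma mem_arcClass {m : ℕ} {E : Finset (Fin n × Fin n)} {σ : Equiv.Perm (Fin n)} :
    σ ∈ arcClass m E ↔ ∀ a b : Fin n, a.val < m → b.val < m → (σ a = b ↔ (a, b) ∈ E) := by
  simp [arcClass]

/-- In every permutation of the class the free sources are the open upper arcs. This is what lets
the weight of a letter be read off the state. -/
lemma mem_freeSrc_iff {m h : ℕ} {E : Finset (Fin n × Fin n)} (hE : IsPartialInj m h E)
    {σ : Equiv.Perm (Fin n)} (hσ : σ ∈ arcClass m E) (a : Fin n) :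
    a ∈ freeSrc m E ↔ a.val < m ∧ m ≤ (σ a).val := by
  rw [mem_arcClass] at hσ
  simp only [freeSrc, mem_filter, mem_univ, true_and]
  refine and_congr_right fun ha => ⟨fun hb => ?_, fun hm b hb => ?_⟩
  · by_contra hlt
    exact hb (σ a) ((hσ a _ ha (by omega)).1 rfl)
  · have h1 := (hσ a b ha (hE.lt _ _ hb).2).2 hb
    have := (hE.lt _ _ hb).2
    rw [h1] at hm
    omega

lemma mem_freeTgt_iff {m h : ℕ} {E : Finset (Fin n × Fin n)} (hE : IsPartialInj m h E)
    {σ : Equiv.Perm (Fin n)} (hσ : σ ∈ arcClass m E) (b : Fin n) :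
    b ∈ freeTgt m E ↔ b.val < m ∧ m ≤ (σ.symm b).val := by
  rw [mem_arcClass] at hσ
  simp only [freeTgt, mem_filter, mem_univ, true_and]
  refine and_congr_right fun hb => ⟨fun ha => ?_, fun hm a ha => ?_⟩
  · by_contra hlt
    exact ha (σ.symm b) ((hσ _ b (by omega) hb).1 (by simp))
  · have h1 := (hσ a b (hE.lt _ _ ha).1 hb).2 ha
    have := (hE.lt _ _ ha).1
    rw [← h1] at hm
    simp at hm
    omega

/-! ### Adding one letter to a partial injection -/

section Children

variable {h : ℕ} {E : Finset (Fin n × Fin n)} {x : Fin n}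

lemma mem_arcClass_succ {σ : Equiv.Perm (Fin n)} :
    σ ∈ arcClass (x.val + 1) E ↔ σ ∈ arcClass x.val E ∧ (∀ a < x, σ a = x ↔ (a, x) ∈ E) ∧
      (∀ b < x, σ x = b ↔ (x, b) ∈ E) ∧ (σ x = x ↔ (x, x) ∈ E) := by
  have hlt : ∀ a : Fin n, a.val < x.val + 1 ↔ a < x ∨ a = x := by
    intro a
    rw [Fin.lt_def, Fin.ext_iff]
    omega
  simp only [mem_arcClass, hlt, ← Fin.lt_def]
  constructor
  · intro h
    exact ⟨fun a b ha hb => h a b (.inl ha) (.inl hb), fun a ha => h a x (.inl ha) (.inr rfl),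
      fun b hb => h x b (.inr rfl) (.inl hb), h x x (.inr rfl) (.inr rfl)⟩
  · rintro ⟨h1, h2, h3, h4⟩ a b (ha | rfl) (hb | rfl)
    · exact h1 a b ha hb
    · exact h2 a ha
    · exact h3 b hb
    · exact h4

lemma mem_arcClass_insert {σ : Equiv.Perm (Fin n)} {a b : Fin n} (hab : x ≤ a ∨ x ≤ b) :
    σ ∈ arcClass x.val (insert (a, b) E) ↔ σ ∈ arcClass x.val E := by
  simp only [mem_arcClass, mem_insert, Prod.mk.injEq, ← Fin.lt_def]
  refine forall₄_congr fun c d hc hd => ?_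
  have : ¬ (c = a ∧ d = b) := by
    rintro ⟨rfl, rfl⟩
    exact hab.elim hc.not_ge hd.not_ge
  simp [this]

lemma IsPartialInj.notMem_left (hE : IsPartialInj x.val h E) (b : Fin n) : (x, b) ∉ E :=
  fun hb => (hE.lt _ _ hb).1.false

lemma IsPartialInj.notMem_right (hE : IsPartialInj x.val h E) (a : Fin n) : (a, x) ∉ E :=
  fun ha => (hE.lt _ _ ha).2.false

/-- This and the next three lemmas show that prescribing how `x` is attached to smaller letters cuts
an arc class down to another arc class, to which induction applies. -/
lemma arcClass_valley (hE : IsPartialInj x.val h E) :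
    {σ ∈ arcClass x.val E | x < σ.symm x ∧ x < σ x} = arcClass (x.val + 1) E := by
  ext σ
  rw [mem_filter, mem_arcClass_succ]
  simp only [hE.notMem_left, hE.notMem_right, iff_false]
  refine and_congr_right fun hσ => ⟨fun ⟨h1, h2⟩ => ⟨?_, ?_, h2.ne'⟩, fun ⟨h1, h2, h3⟩ => ⟨?_, ?_⟩⟩
  · rintro a ha rfl
    simp only [Equiv.symm_apply_apply] at h1
    exact ha.not_gt h1
  · rintro b hb rfl
    exact hb.not_gt h2
  · refine lt_of_le_of_ne (not_lt.1 fun hlt => h1 _ hlt (by simp)) fun heq => h3 ?_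
    rwa [Equiv.eq_symm_apply] at heq
  · exact lt_of_le_of_ne (not_lt.1 fun hlt => h2 _ hlt rfl) (Ne.symm h3)

lemma arcClass_fixed (hE : IsPartialInj x.val h E) :
    {σ ∈ arcClass x.val E | σ x = x} = arcClass (x.val + 1) (insert (x, x) E) := by
  ext σ
  rw [mem_filter, mem_arcClass_succ, mem_arcClass_insert (.inl le_rfl)]
  simp only [hE.notMem_left, hE.notMem_right, mem_insert, Prod.mk.injEq, or_false, and_true,
    true_and, iff_true]
  refine and_congr_right fun hσ => ⟨fun h1 => ⟨?_, ?_, h1⟩, fun h1 => h1.2.2⟩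
  · intro a ha
    exact ⟨fun h => σ.injective (h.trans h1.symm), fun h => h ▸ h1⟩
  · intro b hb
    rw [h1, eq_comm]

lemma arcClass_doubleDrop (hE : IsPartialInj x.val h E) {y : Fin n} (hy : y ∈ freeTgt x.val E) :
    {σ ∈ arcClass x.val E | x < σ.symm x ∧ σ x = y} =
      arcClass (x.val + 1) (insert (x, y) E) := by
  have hyx : y < x := (mem_filter.1 hy).2.1
  ext σ
  rw [mem_filter, mem_arcClass_succ, mem_arcClass_insert (.inl le_rfl)]
  simp only [hE.notMem_left, hE.notMem_right, mem_insert, Prod.mk.injEq, or_false,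
    true_and, hyx.ne', and_false, iff_false]
  refine and_congr_right fun hσ => ⟨fun ⟨h1, h2⟩ => ⟨?_, ?_, ?_⟩, fun ⟨h1, h2, h3⟩ => ⟨?_, ?_⟩⟩
  · rintro a ha rfl
    simp only [Equiv.symm_apply_apply] at h1
    exact ha.not_gt h1
  · intro b hb
    rw [h2, eq_comm]
  · rw [h2]; exact hyx.ne
  · refine lt_of_le_of_ne (not_lt.1 fun hlt => h1 _ hlt (by simp)) fun heq => h3 ?_
    rwa [Equiv.eq_symm_apply] at heq
  · exact (h2 y hyx).2 rfl

lemma arcClass_peak (hE : IsPartialInj x.val h E) {y z : Fin n} (hy : y ∈ freeTgt x.val E)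
    (hz : z ∈ freeSrc x.val E) :
    {σ ∈ arcClass x.val E | σ z = x ∧ σ x = y} =
      arcClass (x.val + 1) (insert (z, x) (insert (x, y) E)) := by
  have hyx : y < x := (mem_filter.1 hy).2.1
  have hzx : z < x := (mem_filter.1 hz).2.1
  ext σ
  rw [mem_filter, mem_arcClass_succ, mem_arcClass_insert (.inr le_rfl),
    mem_arcClass_insert (.inl le_rfl)]
  simp only [hE.notMem_left, hE.notMem_right, mem_insert, Prod.mk.injEq, or_false,
    true_and, hyx.ne', and_false, iff_false, and_true, hzx.ne', false_and, false_or]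
  refine and_congr_right fun hσ => ⟨fun ⟨h1, h2⟩ => ⟨?_, ?_, ?_⟩, fun ⟨h1, h2, h3⟩ => ⟨?_, ?_⟩⟩
  · intro a ha
    exact ⟨fun h => σ.injective (h.trans h1.symm), fun h => h ▸ h1⟩
  · intro b hb
    rw [h2, eq_comm]
  · rw [h2]; exact hyx.ne
  · exact (h1 z hzx).2 rfl
  · exact (h2 y hyx).2 rfl

lemma freeSrc_insert (m : ℕ) (a b : Fin n) : freeSrc m (insert (a, b) E) = (freeSrc m E).erase a := by
  ext c
  simp only [freeSrc, mem_filter, mem_univ, true_and, mem_insert, mem_erase, Prod.mk.injEq, not_or]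
  constructor
  · rintro ⟨h1, h2⟩
    exact ⟨fun h => (h2 b).1 ⟨h, rfl⟩, h1, fun d => (h2 d).2⟩
  · rintro ⟨h1, h2, h3⟩
    exact ⟨h2, fun d => ⟨fun h => h1 h.1, h3 d⟩⟩

lemma freeTgt_insert (m : ℕ) (a b : Fin n) : freeTgt m (insert (a, b) E) = (freeTgt m E).erase b := by
  ext c
  simp only [freeTgt, mem_filter, mem_univ, true_and, mem_insert, mem_erase, Prod.mk.injEq, not_or]
  constructor
  · rintro ⟨h1, h2⟩
    exact ⟨fun h => (h2 a).1 ⟨rfl, h⟩, h1, fun d => (h2 d).2⟩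
  · rintro ⟨h1, h2, h3⟩
    exact ⟨h2, fun d => ⟨fun h => h1 h.2, h3 d⟩⟩

lemma IsPartialInj.freeSrc_succ (hE : IsPartialInj x.val h E) :
    freeSrc (x.val + 1) E = insert x (freeSrc x.val E) := by
  ext a
  have := hE.notMem_left
  simp only [freeSrc, mem_filter, mem_univ, true_and, mem_insert]
  grind

lemma IsPartialInj.freeTgt_succ (hE : IsPartialInj x.val h E) :
    freeTgt (x.val + 1) E = insert x (freeTgt x.val E) := by
  ext a
  have := hE.notMem_right
  simp only [freeTgt, mem_filter, mem_univ, true_and, mem_insert]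
  grind

lemma notMem_freeSrc_self : x ∉ freeSrc x.val E := by simp [freeSrc]

lemma notMem_freeTgt_self : x ∉ freeTgt x.val E := by simp [freeTgt]

lemma IsPartialInj.valley (hE : IsPartialInj x.val h E) :
    IsPartialInj (x.val + 1) (h + 1) E where
  lt a b hab := by have := hE.lt a b hab; omega
  fn := hE.fn
  inj := hE.inj
  card_src := by rw [hE.freeSrc_succ, card_insert_of_notMem notMem_freeSrc_self, hE.card_src]
  card_tgt := by rw [hE.freeTgt_succ, card_insert_of_notMem notMem_freeTgt_self, hE.card_tgt]

lemma IsPartialInj.fixed (hE : IsPartialInj x.val h E) :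
    IsPartialInj (x.val + 1) h (insert (x, x) E) where
  lt a b hab := by have := hE.lt a b; grind
  fn a b c := by have := hE.notMem_left; have := hE.fn a b c; grind
  inj a b c := by have := hE.notMem_right; have := hE.inj a b c; grind
  card_src := by
    rw [freeSrc_insert, hE.freeSrc_succ, erase_insert notMem_freeSrc_self, hE.card_src]
  card_tgt := by
    rw [freeTgt_insert, hE.freeTgt_succ, erase_insert notMem_freeTgt_self, hE.card_tgt]

lemma IsPartialInj.doubleDrop (hE : IsPartialInj x.val h E) {y : Fin n}
    (hy : y ∈ freeTgt x.val E) : IsPartialInj (x.val + 1) h (insert (x, y) E) where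
  lt a b hab := by have := hE.lt a b; simp [freeTgt] at hy; grind
  fn a b c := by have := hE.notMem_left; have := hE.fn a b c; grind
  inj a b c := by simp [freeTgt] at hy; have := hE.inj a b c; grind
  card_src := by
    rw [freeSrc_insert, hE.freeSrc_succ, erase_insert notMem_freeSrc_self, hE.card_src]
  card_tgt := by
    rw [freeTgt_insert, hE.freeTgt_succ, card_erase_of_mem (mem_insert_of_mem hy),
      card_insert_of_notMem notMem_freeTgt_self, hE.card_tgt, Nat.add_sub_cancel]

lemma IsPartialInj.peak (hE : IsPartialInj x.val h E) {y z : Fin n} (hy : y ∈ freeTgt x.val E)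
    (hz : z ∈ freeSrc x.val E) :
    IsPartialInj (x.val + 1) (h - 1) (insert (z, x) (insert (x, y) E)) where
  lt a b hab := by have := hE.lt a b; simp [freeTgt] at hy; simp [freeSrc] at hz; grind
  fn a b c := by
    have := hE.notMem_left; have := hE.fn a b c; simp [freeSrc] at hz; grind
  inj a b c := by
    have := hE.notMem_right; simp [freeTgt] at hy; have := hE.inj a b c; grind
  card_src := by
    rw [freeSrc_insert, freeSrc_insert, hE.freeSrc_succ, erase_insert notMem_freeSrc_self,
      card_erase_of_mem hz, hE.card_src]
  card_tgt := by
    rw [freeTgt_insert, freeTgt_insert, hE.freeTgt_succ, erase_right_comm,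
      erase_insert notMem_freeTgt_self, card_erase_of_mem hy, hE.card_tgt]

lemma cycWt_valley (p q w y : R) {σ : Equiv.Perm (Fin n)} (h1 : x < σ.symm x) (h2 : x < σ x) :
    cycWt p q w y σ x = w := by
  have h3 : nestAt σ x = 0 := by
    simp [nestAt, h1.not_ge, h2.not_gt]
  have h4 : crosAt σ x = 0 := by
    simp only [crosAt, Nat.add_eq_zero_iff, card_eq_zero, filter_eq_empty_iff, mem_univ,
      forall_const]
    exact ⟨fun j hj => absurd (hj.1.trans_le hj.2.1) h1.not_gt,
      fun j hj => absurd (hj.1.trans hj.2.1) h2.not_gt⟩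
  simp [cycWt, h1, h2, h3, h4, h1.not_gt, h2.ne']

lemma cycWt_doubleExc (p q w y : R) {σ : Equiv.Perm (Fin n)} (h1 : σ.symm x < x) (h2 : x < σ x) :
    cycWt p q w y σ x = 0 := by
  simp [cycWt, h1, h2]

/-- The weak inequality in the upper half of `nest` makes a fixed point the inner arc under each of
the `h` open upper arcs, and it begins no crossing. -/
lemma cycWt_fixed (p q w y : R) (hE : IsPartialInj x.val h E) {σ : Equiv.Perm (Fin n)}
    (hσ : σ ∈ arcClass x.val E) (hx : σ x = x) : cycWt p q w y σ x = y * p ^ h := by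
  have hx' : σ.symm x = x := by rw [Equiv.symm_apply_eq, hx]
  have h3 : nestAt σ x = h := by
    rw [← hE.card_src]
    simp only [nestAt, hx, hx', lt_irrefl, false_and, and_false, filter_false, card_empty, add_zero,
      le_refl, true_and]
    congr 1
    ext i
    rw [mem_freeSrc_iff hE hσ]
    simp only [mem_filter, mem_univ, true_and, Fin.lt_def]
    have : (σ i).val = x.val → i = x := fun h => σ.injective ((Fin.ext h).trans hx.symm)
    grind
  have h4 : crosAt σ x = 0 := by
    simp only [crosAt, Nat.add_eq_zero_iff, card_eq_zero, filter_eq_empty_iff, mem_univ,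
      forall_const, hx, hx']
    exact ⟨fun j hj => hj.1.not_ge hj.2.1, fun j hj => hj.1.not_gt hj.2.1⟩
  simp [cycWt, hx, hx', h3, h4, mul_comm]

/-- A target `z` whose arc is open before `x` has source at least `x`, with equality only for `z = σ
x`. The strict comparisons with `σ x` exclude that case. -/
lemma card_nestAt_right (hE : IsPartialInj x.val h E) {σ : Equiv.Perm (Fin n)}
    (hσ : σ ∈ arcClass x.val E) (h1 : σ x < x) (_h2 : σ.symm x ≠ x) :
    #{z | z < σ x ∧ x < σ.symm z} = #{a ∈ freeTgt x.val E | σ x > a} := by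
  congr 1
  ext z
  simp only [mem_filter, mem_univ, true_and, mem_freeTgt_iff hE hσ]
  have : (σ.symm z).val = x.val → z = σ x := fun h => by
    rw [← Equiv.symm_apply_eq]; exact Fin.ext h
  grind

lemma card_crosAt_right (hE : IsPartialInj x.val h E) {σ : Equiv.Perm (Fin n)}
    (hσ : σ ∈ arcClass x.val E) (_h2 : σ.symm x ≠ x) :
    #{z | σ x < z ∧ z < x ∧ x < σ.symm z} = #{a ∈ freeTgt x.val E | a > σ x} := by
  congr 1
  ext z
  simp only [mem_filter, mem_univ, true_and, mem_freeTgt_iff hE hσ]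
  have : (σ.symm z).val = x.val → z = σ x := fun h => by
    rw [← Equiv.symm_apply_eq]; exact Fin.ext h
  grind

lemma cycWt_doubleDrop (p q w y : R) (hE : IsPartialInj x.val h E) {σ : Equiv.Perm (Fin n)}
    (hσ : σ ∈ arcClass x.val E) {t : Fin n} (ht : t ∈ freeTgt x.val E)
    (h1 : x < σ.symm x) (h2 : σ x = t) :
    cycWt p q w y σ x =
      q ^ #{a ∈ freeTgt x.val E | a > t} * p ^ #{a ∈ freeTgt x.val E | t > a} := by
  subst h2
  have htx : σ x < x := (mem_filter.1 ht).2.1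
  have h0 : ∀ j, ¬ (σ.symm x < j ∧ j ≤ x ∧ x < σ j) :=
    fun j hj => h1.not_gt (hj.1.trans_le hj.2.1)
  simp [cycWt, nestAt, crosAt, h1.not_ge, h1.not_gt, htx, htx.ne, htx.not_gt, h0,
    card_nestAt_right hE hσ htx h1.ne', card_crosAt_right hE hσ h1.ne', mul_comm]

/-- Closing a lower arc and an upper arc gives two independent ranks: among open arcs of the same
kind, those with larger small end are crossed and those with smaller small end nest the closed arc.
-/
lemma cycWt_peak (p q w y : R) (hE : IsPartialInj x.val h E) {σ : Equiv.Perm (Fin n)}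
    (hσ : σ ∈ arcClass x.val E) {s t : Fin n} (ht : t ∈ freeTgt x.val E)
    (hs : s ∈ freeSrc x.val E) (h1 : σ s = x) (h2 : σ x = t) :
    cycWt p q w y σ x =
      (q ^ #{a ∈ freeTgt x.val E | a > t} * p ^ #{a ∈ freeTgt x.val E | t > a}) *
      (q ^ #{a ∈ freeSrc x.val E | a > s} * p ^ #{a ∈ freeSrc x.val E | s > a}) := by
  subst h2
  obtain rfl : s = σ.symm x := by rw [Equiv.eq_symm_apply, h1]
  have htx : σ x < x := (mem_filter.1 ht).2.1
  have hsx : σ.symm x < x := (mem_filter.1 hs).2.1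
  have e1 : #{i | i < σ.symm x ∧ x < σ i} = #{a ∈ freeSrc x.val E | σ.symm x > a} := by
    congr 1
    ext i
    simp only [mem_filter, mem_univ, true_and, mem_freeSrc_iff hE hσ]
    have : (σ i).val = x.val → i = σ.symm x := fun h => by
      rw [Equiv.eq_symm_apply]; exact Fin.ext h
    grind
  have e2 : #{j | σ.symm x < j ∧ j ≤ x ∧ x < σ j} = #{a ∈ freeSrc x.val E | a > σ.symm x} := by
    congr 1
    ext i
    simp only [mem_filter, mem_univ, true_and, mem_freeSrc_iff hE hσ]
    have : (σ i).val = x.val → i = σ.symm x := fun h => by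
      rw [Equiv.eq_symm_apply]; exact Fin.ext h
    have : i.val = x.val → i = x := Fin.ext
    grind
  simp only [cycWt, nestAt, crosAt, hsx.le, htx, htx.ne, htx.not_gt, hsx.not_gt,
    card_nestAt_right hE hσ htx hsx.ne, card_crosAt_right hE hσ hsx.ne, true_and, e1, e2,
    and_false, if_false, mul_one, pow_add]
  ring

end Children

/-- Induction on the number `r` of letters still to be admitted. The sum depends on the state `E`
only through its height. -/
lemma sum_arcClass (p q w y : R) (r m h : ℕ) (hm : m + r = n) (E : Finset (Fin n × Fin n))
    (hE : IsPartialInj m h E) :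
    ∑ σ ∈ arcClass m E, ∏ x with m ≤ x.val, cycWt p q w y σ x = cycPaths p q w y r h := by
  induction r generalizing m h E with
  | zero =>
    obtain rfl : m = n := by omega
    have hprod : ∀ σ : Equiv.Perm (Fin m), ∏ x with m ≤ x.val, cycWt p q w y σ x = 1 := by
      intro σ
      rw [filter_false_of_mem, prod_empty]
      intro x _
      have := x.2
      omega
    simp only [hprod, sum_const, cycPaths]
    -- With all letters admitted, height 0 means that `E` is the graph of one permutation; a
    -- positive height is impossible.
    split_ifs with h0
    · subst h0
      have hsrc : ∀ a, ∃ b, (a, b) ∈ E := by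
        intro a
        by_contra hcon
        push Not at hcon
        have : a ∈ freeSrc m E := by simp [freeSrc, hcon]
        rw [card_eq_zero.1 hE.card_src] at this
        simp at this
      choose f hf using hsrc
      have hfi : Function.Injective f := fun a b hab =>
        hE.inj a b (f b) (hab ▸ hf a) (hf b)
      have : arcClass m E = {Equiv.ofBijective f (Finite.injective_iff_bijective.1 hfi)} := by
        ext σ
        rw [mem_arcClass, mem_singleton]
        constructor
        · intro hσ
          ext a
          have := (hσ a (f a) a.2 (f a).2).2 (hf a)
          simp [this]
        · rintro rfl a b _ _
          simp only [Equiv.ofBijective_apply]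
          exact ⟨fun h => h ▸ hf a, fun h => hE.fn a _ _ (hf a) h⟩
      simp [this]
    · have : arcClass m E = ∅ := by
        rw [eq_empty_iff_forall_notMem]
        intro σ hσ
        have : freeSrc m E = ∅ := by
          rw [eq_empty_iff_forall_notMem]
          intro a ha
          have := ((mem_freeSrc_iff hE hσ a).1 ha).2
          have := (σ a).2
          omega
        have h1 := hE.card_src
        rw [this] at h1
        exact h0 (by simpa using h1.symm)
      simp [this]
  | succ r ih =>
    obtain ⟨x, rfl⟩ : ∃ x : Fin n, x.val = m := ⟨⟨m, by omega⟩, rfl⟩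
    have hprod : ∀ σ : Equiv.Perm (Fin n), ∏ z with x.val ≤ z.val, cycWt p q w y σ z =
        cycWt p q w y σ x * ∏ z with x.val + 1 ≤ z.val, cycWt p q w y σ z := by
      intro σ
      rw [← prod_insert (by simp)]
      congr 1
      ext z
      simp only [mem_filter, mem_univ, true_and, mem_insert, Fin.ext_iff]
      omega
    simp only [hprod]
    set F : Equiv.Perm (Fin n) → R := fun σ => ∏ z with x.val + 1 ≤ z.val, cycWt p q w y σ z
      with hF
    have key : ∀ E' h', IsPartialInj (x.val + 1) h' E' →
        ∑ σ ∈ arcClass (x.val + 1) E', F σ = cycPaths p q w y r h' :=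
      fun E' h' hE' => ih (x.val + 1) h' (by omega) E' hE'
    have hval : ∑ σ ∈ arcClass x.val E with x < σ.symm x ∧ x < σ x, cycWt p q w y σ x * F σ =
        w * cycPaths p q w y r (h + 1) := by
      rw [← key _ _ hE.valley, ← arcClass_valley hE, mul_sum]
      refine sum_congr rfl fun σ hσ => ?_
      rw [mem_filter] at hσ
      rw [cycWt_valley _ _ _ _ hσ.2.1 hσ.2.2]
    have hfix : ∑ σ ∈ arcClass x.val E with σ x = x, cycWt p q w y σ x * F σ =
        y * p ^ h * cycPaths p q w y r h := by
      rw [← key _ _ hE.fixed, ← arcClass_fixed hE, mul_sum]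
      refine sum_congr rfl fun σ hσ => ?_
      rw [mem_filter] at hσ
      rw [cycWt_fixed _ _ _ _ hE hσ.1 hσ.2]
    -- The order used is `>`: the predecessors of `t` are the larger free letters, which produce
    -- crossings.
    have hsum : ∀ s : Finset (Fin n),
        ∑ t ∈ s, q ^ #{a ∈ s | a > t} * p ^ #{a ∈ s | t > a} = pqNat p q #s := by
      intro s
      refine sum_pow_pred_mul_pow_succ p q s (· > ·) ?_ ?_ ?_
      · intro a _; exact lt_irrefl a
      · intro a _ b _ c _ h1 h2; exact h2.trans h1
      · intro a _ b _ hab; exact (lt_or_gt_of_ne hab).symm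
    have hdd : ∑ σ ∈ arcClass x.val E with x < σ.symm x ∧ σ x < x, cycWt p q w y σ x * F σ =
        pqNat p q h * cycPaths p q w y r h := by
      rw [← hE.card_tgt, ← hsum, sum_mul, hE.card_tgt,
        ← sum_fiberwise_of_maps_to (g := fun σ : Equiv.Perm (Fin n) => σ x)
          (t := freeTgt x.val E)]
      · refine sum_congr rfl fun t ht => ?_
        have htx : t < x := (mem_filter.1 ht).2.1
        rw [← key _ _ (hE.doubleDrop ht), ← arcClass_doubleDrop hE ht, mul_sum, filter_filter]
        refine sum_congr ?_ fun σ hσ => ?_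
        · ext σ
          simp only [mem_filter]
          constructor
          · tauto
          · rintro ⟨h1, h2, h3⟩
            exact ⟨h1, ⟨h2, h3 ▸ htx⟩, h3⟩
        · rw [mem_filter] at hσ
          rw [cycWt_doubleDrop p q w y hE hσ.1 ht hσ.2.1 hσ.2.2]
      · intro σ hσ
        rw [mem_filter] at hσ
        rw [mem_freeTgt_iff hE hσ.1]
        exact ⟨hσ.2.2, by simp⟩
    have hpk : ∑ σ ∈ arcClass x.val E with σ.symm x < x ∧ σ x < x, cycWt p q w y σ x * F σ =
        pqNat p q h ^ 2 * cycPaths p q w y r (h - 1) := by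
      rw [sq]
      nth_rewrite 1 [← hE.card_tgt]
      rw [← hE.card_src, ← hsum, ← hsum, sum_mul_sum, ← sum_product', sum_mul, hE.card_src,
        ← sum_fiberwise_of_maps_to (g := fun σ : Equiv.Perm (Fin n) => (σ x, σ.symm x))
          (t := freeTgt x.val E ×ˢ freeSrc x.val E)]
      · refine sum_congr rfl fun ⟨t, s⟩ hst => ?_
        obtain ⟨ht, hs⟩ := mem_product.1 hst
        have htx : t < x := (mem_filter.1 ht).2.1
        have hsx : s < x := (mem_filter.1 hs).2.1
        rw [← key _ _ (hE.peak ht hs), ← arcClass_peak hE ht hs, mul_sum, filter_filter]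
        refine sum_congr ?_ fun σ hσ => ?_
        · ext σ
          simp only [mem_filter, Prod.mk.injEq, Equiv.symm_apply_eq]
          constructor
          · rintro ⟨h1, ⟨h2, h3⟩, h4, h5⟩
            exact ⟨h1, h5.symm, h4⟩
          · rintro ⟨h1, h2, h3⟩
            refine ⟨h1, ⟨?_, h3 ▸ htx⟩, h3, h2.symm⟩
            rwa [← h2, Equiv.symm_apply_apply, h2]
        · rw [mem_filter] at hσ
          rw [cycWt_peak p q w y hE hσ.1 ht hs hσ.2.1 hσ.2.2]
      · intro σ hσ
        rw [mem_filter] at hσ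
        rw [mem_product, mem_freeTgt_iff hE hσ.1, mem_freeSrc_iff hE hσ.1]
        exact ⟨⟨hσ.2.2, by simp⟩, hσ.2.1, by simp⟩
    -- The fifth type, the double excedance, has weight zero and so has no summand.
    have hsplit : ∀ σ : Equiv.Perm (Fin n), cycWt p q w y σ x * F σ =
        (if x < σ.symm x ∧ x < σ x then cycWt p q w y σ x * F σ else 0) +
        (if σ x = x then cycWt p q w y σ x * F σ else 0) +
        (if x < σ.symm x ∧ σ x < x then cycWt p q w y σ x * F σ else 0) +
        (if σ.symm x < x ∧ σ x < x then cycWt p q w y σ x * F σ else 0) := by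
      intro σ
      have hfx : σ.symm x = x ↔ σ x = x := by
        rw [Equiv.symm_apply_eq]
        exact eq_comm
      rcases lt_trichotomy (σ x) x with h1 | h1 | h1
      · have h2 : σ.symm x ≠ x := fun h => h1.ne (hfx.1 h)
        rcases lt_or_gt_of_ne h2 with h2 | h2 <;> simp [h1, h2, h1.not_gt, h2.not_gt, h1.ne]
      · simp [h1, hfx.2 h1]
      · have h2 : σ.symm x ≠ x := fun h => h1.ne' (hfx.1 h)
        rcases lt_or_gt_of_ne h2 with h2 | h2
        · simp [cycWt_doubleExc p q w y h2 h1]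
        · simp [h1, h2, h1.not_gt, h1.ne']
    rw [sum_congr rfl fun σ _ => hsplit σ]
    simp only [sum_add_distrib, ← sum_filter, hval, hfix, hdd, hpk, cycPaths]
    ring

theorem B_eq_cycPaths (p q w y : R) : B n p q 1 0 1 w y = cycPaths p q w y n 0 := by
  rw [B_eq_sum_prod_cycWt, ← sum_arcClass p q w y n 0 0 (Nat.zero_add n) ∅
    ⟨by simp, by simp, by simp, by simp [freeSrc], by simp [freeTgt]⟩]
  simp [arcClass]

end CyclicSide

end PermStat

namespace PermStat

open Finset

/-! ### Linear statistics and blocks of small letters -/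

section LinearSide

variable {n : ℕ}

/-- The left neighbour of the letter `a` in the word of `σ` exists and is at least `m`. -/
def LeftLarge (σ : Equiv.Perm (Fin n)) (m : ℕ) (a : Fin n) : Prop :=
  ∃ c : Fin n, m ≤ c.val ∧ (σ.symm c).val + 1 = (σ.symm a).val

instance (σ : Equiv.Perm (Fin n)) (m : ℕ) : DecidablePred (LeftLarge σ m) :=
  fun a => by unfold LeftLarge; infer_instance

/-- The right neighbour of the letter `x` in the word of `σ` exists and is smaller than `x`. -/
def RightSmall (σ : Equiv.Perm (Fin n)) (x : Fin n) : Prop :=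
  ∃ c < x, (σ.symm x).val + 1 = (σ.symm c).val

instance (σ : Equiv.Perm (Fin n)) : DecidablePred (RightSmall σ) :=
  fun a => by unfold RightSmall; infer_instance

/-- The letter `x` is a left-to-right maximum of the word of `σ`. -/
def IsLeftMax (σ : Equiv.Perm (Fin n)) (x : Fin n) : Prop :=
  ∀ c, σ.symm c < σ.symm x → c < x

instance (σ : Equiv.Perm (Fin n)) : DecidablePred (IsLeftMax σ) :=
  fun a => by unfold IsLeftMax; infer_instance

/-- The letters that play the part of `1` in an occurrence of `31-2` in which `x` is the `2`. -/
def startsBefore (σ : Equiv.Perm (Fin n)) (x : Fin n) : Finset (Fin n) :=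
  {a | a < x ∧ σ.symm a < σ.symm x ∧ LeftLarge σ (x.val + 1) a}

/-- The letters that play the part of `1` in an occurrence of `2-31` in which `x` is the `2`. -/
def startsAfter (σ : Equiv.Perm (Fin n)) (x : Fin n) : Finset (Fin n) :=
  {a | a < x ∧ σ.symm x < σ.symm a ∧ LeftLarge σ (x.val + 1) a}

variable {R : Type*} [CommSemiring R]

/-- The contribution of the letter `x` to the linear weight of `σ`. -/
def linWt (p q w y : R) (σ : Equiv.Perm (Fin n)) (x : Fin n) : R :=
  p ^ #(startsAfter σ x) * q ^ #(startsBefore σ x) *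
    (if LeftLarge σ (x.val + 1) x ∧ ¬ RightSmall σ x then w else 1) *
    (if ¬ LeftLarge σ (x.val + 1) x ∧ ¬ RightSmall σ x then (if IsLeftMax σ x then y else 0) else 1)

/-- If some larger letter precedes `x`, the last such letter is followed by a letter smaller than
`x`, since `x` itself has no larger left neighbour. This descent forms a `31-2` with `x`. So the
foremaximum condition is a condition on the exponent of `q`. -/
lemma isLeftMax_iff {σ : Equiv.Perm (Fin n)} {x : Fin n} (hx : ¬ LeftLarge σ (x.val + 1) x) :
    IsLeftMax σ x ↔ #(startsBefore σ x) = 0 := by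
  rw [card_eq_zero, eq_empty_iff_forall_notMem]
  simp only [startsBefore, mem_filter, mem_univ, true_and]
  constructor
  · rintro h a ⟨_, h2, c, h3, h4⟩
    have := h c (by rw [Fin.lt_def] at h2 ⊢; omega)
    rw [Fin.lt_def] at this
    omega
  · intro h
    by_contra hcon
    simp only [IsLeftMax, not_forall, not_lt] at hcon
    obtain ⟨c₀, hc₀, hc₀'⟩ := hcon
    obtain ⟨c, hc, hmax⟩ := exists_max_image
      (univ.filter fun c => σ.symm c < σ.symm x ∧ x ≤ c) (fun c => σ.symm c)
      ⟨c₀, by simp [hc₀, hc₀']⟩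
    simp only [mem_filter, mem_univ, true_and] at hc hmax
    have hcx : x.val + 1 ≤ c.val := by
      have : c ≠ x := by rintro rfl; exact hc.1.false
      have := hc.2.lt_of_ne this.symm
      exact this
    have hlt := Fin.lt_def.1 hc.1
    obtain ⟨d, hd⟩ : ∃ d, (σ.symm d).val = (σ.symm c).val + 1 :=
      ⟨σ ⟨(σ.symm c).val + 1, by omega⟩, by simp⟩
    have hdx : d ≠ x := by
      rintro rfl
      exact hx ⟨c, hcx, hd.symm⟩
    have hdp : σ.symm d < σ.symm x := by
      refine lt_of_le_of_ne (Fin.le_def.2 (by omega)) fun he => hdx (σ.symm.injective he)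
    rcases lt_or_ge d x with h1 | h1
    · exact h d ⟨h1, hdp, c, hcx, hd.symm⟩
    · have := Fin.le_def.1 (hmax d ⟨hdp, h1⟩)
      omega

/-- `r` is a strict total order on the letters `< m` and `S` consists of `h` letters `< m`. -/
structure IsBlockOrder (m h : ℕ) (r : Finset (Fin n × Fin n)) (S : Finset (Fin n)) : Prop where
  lt : ∀ a b, (a, b) ∈ r → a.val < m ∧ b.val < m
  irrefl : ∀ a, (a, a) ∉ r
  trans : ∀ a b c, (a, b) ∈ r → (b, c) ∈ r → (a, c) ∈ r
  total : ∀ a b : Fin n, a.val < m → b.val < m → a ≠ b → (a, b) ∈ r ∨ (b, a) ∈ r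
  lt_of_mem : ∀ a ∈ S, a.val < m
  card_eq : #S = h

/-- The permutations whose word orders the letters `< m` by `r` and for which `S` is the set of
letters `< m` with left neighbour at least `m`. -/
def blockClass (m : ℕ) (r : Finset (Fin n × Fin n)) (S : Finset (Fin n)) :
    Finset (Equiv.Perm (Fin n)) :=
  {σ | (∀ a b : Fin n, a.val < m → b.val < m → (σ.symm a < σ.symm b ↔ (a, b) ∈ r)) ∧
    ∀ a : Fin n, a.val < m → (a ∈ S ↔ LeftLarge σ m a)}

lemma mem_blockClass {m : ℕ} {r : Finset (Fin n × Fin n)} {S : Finset (Fin n)}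
    {σ : Equiv.Perm (Fin n)} : σ ∈ blockClass m r S ↔
      (∀ a b : Fin n, a.val < m → b.val < m → (σ.symm a < σ.symm b ↔ (a, b) ∈ r)) ∧
      ∀ a : Fin n, a.val < m → (a ∈ S ↔ LeftLarge σ m a) := by
  simp [blockClass]

/-- `y` is the first letter smaller than `x` to the right of `x` in the word of `σ`. -/
def IsNext (σ : Equiv.Perm (Fin n)) (x y : Fin n) : Prop :=
  y < x ∧ σ.symm x < σ.symm y ∧ ∀ b < x, σ.symm x < σ.symm b → σ.symm y ≤ σ.symm b

instance (σ : Equiv.Perm (Fin n)) (x : Fin n) : DecidablePred (IsNext σ x) :=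
  fun a => by unfold IsNext; infer_instance

/-- All letters smaller than `x` are to the left of `x` in the word of `σ`. -/
def IsEnd (σ : Equiv.Perm (Fin n)) (x : Fin n) : Prop :=
  ∀ b < x, ¬ σ.symm x < σ.symm b

instance (σ : Equiv.Perm (Fin n)) : DecidablePred (IsEnd σ) :=
  fun a => by unfold IsEnd; infer_instance

lemma isEnd_or_isNext (σ : Equiv.Perm (Fin n)) (x : Fin n) : IsEnd σ x ∨ ∃ y, IsNext σ x y := by
  by_cases h : IsEnd σ x
  · exact .inl h
  · right
    simp only [IsEnd, not_forall, not_not] at h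
    obtain ⟨b, hb, hb'⟩ := h
    obtain ⟨y, hy, hmin⟩ := exists_min_image
      (univ.filter fun b => b < x ∧ σ.symm x < σ.symm b) (fun b => σ.symm b)
      ⟨b, by simp [hb, hb']⟩
    simp only [mem_filter, mem_univ, true_and] at hy hmin
    exact ⟨y, hy.1, hy.2, fun b h1 h2 => hmin b ⟨h1, h2⟩⟩

lemma IsNext.not_isEnd {σ : Equiv.Perm (Fin n)} {x y : Fin n} (h : IsNext σ x y) : ¬ IsEnd σ x :=
  fun h' => h' y h.1 h.2.1

lemma IsNext.unique {σ : Equiv.Perm (Fin n)} {x y z : Fin n} (hy : IsNext σ x y)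
    (hz : IsNext σ x z) : y = z :=
  σ.symm.injective (le_antisymm (hy.2.2 z hz.1 hz.2.1) (hz.2.2 y hy.1 hy.2.1))

/-- A left neighbour of `y` smaller than `x` would be an earlier candidate to the right of `x`. So
`x` can only stand in front of a block start. -/
lemma IsNext.leftLarge {σ : Equiv.Perm (Fin n)} {x y : Fin n} (h : IsNext σ x y) :
    LeftLarge σ x.val y := by
  have h1 := Fin.lt_def.1 h.2.1
  refine ⟨σ ⟨(σ.symm y).val - 1, by omega⟩, ?_, by simp; omega⟩
  by_contra hlt
  set c := σ ⟨(σ.symm y).val - 1, by omega⟩ with hc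
  have hcp : (σ.symm c).val = (σ.symm y).val - 1 := by simp [hc]
  have hcx : c < x := Fin.lt_def.2 (by omega)
  have hne : σ.symm x ≠ σ.symm c := fun he => hcx.ne' (σ.symm.injective he)
  have h2 : σ.symm x < σ.symm c := lt_of_le_of_ne (Fin.le_def.2 (by omega)) hne
  have := Fin.le_def.1 (h.2.2 c hcx h2)
  omega

lemma leftLarge_succ_iff {σ : Equiv.Perm (Fin n)} {x a : Fin n} :
    LeftLarge σ (x.val + 1) a ↔ LeftLarge σ x.val a ∧ (σ.symm x).val + 1 ≠ (σ.symm a).val := by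
  constructor
  · rintro ⟨c, h1, h2⟩
    refine ⟨⟨c, by omega, h2⟩, fun h3 => ?_⟩
    have : c = x := σ.symm.injective (Fin.ext (by omega))
    subst this
    omega
  · rintro ⟨⟨c, h1, h2⟩, h3⟩
    refine ⟨c, ?_, h2⟩
    have : c.val ≠ x.val := fun h => h3 (Fin.ext h ▸ h2)
    omega

lemma IsNext.leftLarge_succ_iff_of_ne {σ : Equiv.Perm (Fin n)} {x y a : Fin n} (h : IsNext σ x y)
    (ha : a < x) (hay : a ≠ y) : LeftLarge σ (x.val + 1) a ↔ LeftLarge σ x.val a := by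
  rw [leftLarge_succ_iff, and_iff_left]
  intro h1
  have h2 := Fin.le_def.1 (h.2.2 a ha (Fin.lt_def.2 (by omega)))
  have h3 := Fin.lt_def.1 h.2.1
  exact hay (σ.symm.injective (Fin.ext (by omega)))

lemma IsEnd.leftLarge_succ_iff {σ : Equiv.Perm (Fin n)} {x a : Fin n} (h : IsEnd σ x)
    (ha : a < x) : LeftLarge σ (x.val + 1) a ↔ LeftLarge σ x.val a := by
  rw [PermStat.leftLarge_succ_iff, and_iff_left]
  intro h1
  exact h a ha (Fin.lt_def.2 (by omega))

lemma IsNext.leftLarge_succ_self_iff {σ : Equiv.Perm (Fin n)} {x y : Fin n} (h : IsNext σ x y) :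
    LeftLarge σ (x.val + 1) y ↔ ¬ RightSmall σ x := by
  rw [leftLarge_succ_iff, and_iff_right h.leftLarge, not_iff_not]
  constructor
  · exact fun h1 => ⟨y, h.1, h1⟩
  · rintro ⟨c, h1, h2⟩
    have h3 := Fin.le_def.1 (h.2.2 c h1 (Fin.lt_def.2 (by omega)))
    have h4 := Fin.lt_def.1 h.2.1
    omega

lemma IsEnd.not_rightSmall {σ : Equiv.Perm (Fin n)} {x : Fin n} (h : IsEnd σ x) :
    ¬ RightSmall σ x := by
  rintro ⟨c, h1, h2⟩
  exact h c h1 (Fin.lt_def.2 (by omega))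

/-- The order `r` with a new letter `x` inserted just to the left of the letters of `U`. -/
def insertOrder (r : Finset (Fin n × Fin n)) (x : Fin n) (U : Finset (Fin n)) :
    Finset (Fin n × Fin n) :=
  {ab | ab ∈ r ∨ (ab.2 = x ∧ ab.1 < x ∧ ab.1 ∉ U) ∨ (ab.1 = x ∧ ab.2 ∈ U)}

lemma mem_insertOrder {r : Finset (Fin n × Fin n)} {x : Fin n} {U : Finset (Fin n)} {a b : Fin n} :
    (a, b) ∈ insertOrder r x U ↔ (a, b) ∈ r ∨ (b = x ∧ a < x ∧ a ∉ U) ∨ (a = x ∧ b ∈ U) := by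
  simp [insertOrder]

/-! ### Adding one letter to an ordered family of blocks -/

section Children

variable {h : ℕ} {r : Finset (Fin n × Fin n)} {S : Finset (Fin n)} {x : Fin n}

/-- That `U` is closed upwards is what keeps the extended relation transitive. -/
lemma IsBlockOrder.insert (hr : IsBlockOrder x.val h r S) {U : Finset (Fin n)}
    (hU : ∀ b ∈ U, b < x) (hup : ∀ a ∈ U, ∀ b, (a, b) ∈ r → b ∈ U) {S' : Finset (Fin n)} {h' : ℕ}
    (hS : ∀ a ∈ S', a ≤ x) (hcard : #S' = h') :
    IsBlockOrder (x.val + 1) h' (insertOrder r x U) S' where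
  lt a b hab := by
    have := hr.lt a b
    have := hU b
    rw [mem_insertOrder] at hab
    grind
  irrefl a := by
    have := hr.irrefl a
    have := hU a
    rw [mem_insertOrder]
    grind
  trans a b c hab hbc := by
    rw [mem_insertOrder] at *
    have := hr.trans a b c
    have := hr.lt a b
    have := hr.lt b c
    have := hup a
    have := hup b
    have := hU b
    have := hU c
    have := hr.total a c
    grind
  total a b ha hb hab := by
    have h1 := hr.total a b
    simp only [mem_insertOrder]
    have h2 : a = x ∨ a < x := by rw [Fin.ext_iff, Fin.lt_def]; omega
    have h3 : b = x ∨ b < x := by rw [Fin.ext_iff, Fin.lt_def]; omega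
    grind
  lt_of_mem a ha := by have := Fin.le_def.1 (hS a ha); omega
  card_eq := hcard

lemma mem_blockClass_insertOrder (hr : IsBlockOrder x.val h r S) {U S' : Finset (Fin n)}
    (hU : ∀ b ∈ U, b < x) {σ : Equiv.Perm (Fin n)} :
    σ ∈ blockClass (x.val + 1) (insertOrder r x U) S' ↔
      (∀ a < x, ∀ b < x, (σ.symm a < σ.symm b ↔ (a, b) ∈ r)) ∧
      (∀ b < x, (σ.symm x < σ.symm b ↔ b ∈ U)) ∧
      (∀ a < x, (a ∈ S' ↔ LeftLarge σ (x.val + 1) a)) ∧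
      (x ∈ S' ↔ LeftLarge σ (x.val + 1) x) := by
  have hlt : ∀ a : Fin n, a.val < x.val + 1 ↔ a < x ∨ a = x := by
    intro a
    rw [Fin.lt_def, Fin.ext_iff]
    omega
  have hx1 : ∀ a, (x, a) ∉ r := fun a ha => (hr.lt _ _ ha).1.false
  have hx2 : ∀ a, (a, x) ∉ r := fun a ha => (hr.lt _ _ ha).2.false
  have hxU : x ∉ U := fun hx => (hU x hx).false
  rw [mem_blockClass]
  simp only [hlt, mem_insertOrder]
  constructor
  · rintro ⟨h1, h2⟩
    refine ⟨fun a ha b hb => ?_, fun b hb => ?_, fun a ha => h2 a (.inl ha), h2 x (.inr rfl)⟩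
    · rw [h1 a b (.inl ha) (.inl hb)]
      simp [ha.ne, hb.ne]
    · rw [h1 x b (.inr rfl) (.inl hb)]
      simp [hx1, hb.ne]
  · rintro ⟨h1, h2, h3, h4⟩
    refine ⟨?_, ?_⟩
    · rintro a b (ha | rfl) (hb | rfl)
      · simp [h1 a ha b hb, ha.ne, hb.ne]
      · have hne : σ.symm a ≠ σ.symm b := fun he => ha.ne (σ.symm.injective he)
        have := h2 a ha
        simp only [hx2, ha, ha.ne, true_and, false_and, or_false, false_or, ← this, not_lt]
        exact ⟨le_of_lt, fun h => lt_of_le_of_ne h hne⟩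
      · simp [h2 b hb, hx1, hb.ne]
      · simp [hx1, hxU]
    · rintro a (ha | rfl)
      · exact h3 a ha
      · exact h4

/-- The set of block starts after a new letter `x` has been put next to the block start `y`: `l`
tells whether `x` starts a block, `g` whether `x` is glued to `y`. -/
def newStarts (S : Finset (Fin n)) (x y : Fin n) (l g : Bool) : Finset (Fin n) :=
  {a | (a ∈ S ∧ (a = y → g = false)) ∨ (a = x ∧ l = true)}

/-- Gluing removes `y` from the block starts and `l` adds `x`. The subtraction never truncates, as
`y ∈ S` forces `h > 0`. -/
lemma card_newStarts (hr : IsBlockOrder x.val h r S) {y : Fin n} (hy : y ∈ S) (l g : Bool) :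
    #(newStarts S x y l g) = h + l.toNat - g.toNat := by
  have hx : x ∉ S := fun hx => (hr.lt_of_mem x hx).false
  rw [← hr.card_eq]
  have h1 : newStarts S x y false false = S := by ext a; simp [newStarts]
  have h2 : newStarts S x y true false = insert x S := by
    ext a; simp only [newStarts, mem_filter, mem_univ, true_and, mem_insert]; grind
  have h3 : newStarts S x y false true = S.erase y := by
    ext a; simp only [newStarts, mem_filter, mem_univ, true_and, mem_erase]; grind
  have h4 : newStarts S x y true true = insert x (S.erase y) := by
    ext a; simp only [newStarts, mem_filter, mem_univ, true_and, mem_erase, mem_insert]; grind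
  have hpos := card_pos.2 ⟨y, hy⟩
  cases l <;> cases g
  · simp [h1]
  · simp [h3, card_erase_of_mem hy]
  · simp [h2, card_insert_of_notMem hx]
  · rw [h4, card_insert_of_notMem (by simp [hx]), card_erase_of_mem hy]
    simp
    omega

/-- The up-set of `y` in the order `r`. -/
def upSet (r : Finset (Fin n × Fin n)) (y : Fin n) : Finset (Fin n) := {b | b = y ∨ (y, b) ∈ r}

lemma mem_upSet {y b : Fin n} : b ∈ upSet r y ↔ b = y ∨ (y, b) ∈ r := by simp [upSet]

lemma blockClass_next (hr : IsBlockOrder x.val h r S) {y : Fin n} (hy : y ∈ S) (l g : Bool) :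
    {σ ∈ blockClass x.val r S | IsNext σ x y ∧ decide (LeftLarge σ (x.val + 1) x) = l ∧
      decide (RightSmall σ x) = g} =
    blockClass (x.val + 1) (insertOrder r x (upSet r y)) (newStarts S x y l g) := by
  have hyx : y < x := hr.lt_of_mem y hy
  have hx : x ∉ S := fun hx => (hr.lt_of_mem x hx).false
  have hU : ∀ b ∈ upSet r y, b < x := by
    intro b hb
    rcases mem_upSet.1 hb with rfl | hb
    · exact hyx
    · exact (hr.lt _ _ hb).2
  ext σ
  rw [mem_filter, mem_blockClass_insertOrder hr hU, mem_blockClass]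
  simp only [← Fin.lt_def]
  have hnext : (∀ a b, a < x → b < x → (σ.symm a < σ.symm b ↔ (a, b) ∈ r)) →
      (IsNext σ x y ↔ ∀ b < x, (σ.symm x < σ.symm b ↔ b ∈ upSet r y)) := by
    intro hord
    simp only [mem_upSet]
    constructor
    · rintro ⟨h1, h2, h3⟩ b hb
      rw [← hord y b hyx hb]
      constructor
      · intro h4
        rcases (h3 b hb h4).eq_or_lt with h5 | h5
        · exact .inl (σ.symm.injective h5).symm
        · exact .inr h5
      · rintro (rfl | h4)
        · exact h2
        · exact h2.trans h4
    · intro h1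
      refine ⟨hyx, (h1 y hyx).2 (.inl rfl), fun b hb hb' => ?_⟩
      rcases (h1 b hb).1 hb' with rfl | h2
      · exact le_rfl
      · exact ((hord y b hyx hb).2 h2).le
  constructor
  · rintro ⟨⟨h1, h2⟩, h3, rfl, rfl⟩
    refine ⟨fun a ha b hb => h1 a b ha hb, (hnext h1).1 h3, fun a ha => ?_, ?_⟩
    · simp only [newStarts, mem_filter, mem_univ, true_and, ha.ne, false_and, or_false,
        decide_eq_false_iff_not]
      by_cases hay : a = y
      · subst hay
        simp [hy, h3.leftLarge_succ_self_iff]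
      · simp [hay, h2 a ha, h3.leftLarge_succ_iff_of_ne ha hay]
    · simp [newStarts, hx]
  · rintro ⟨h1, h2, h3, h4⟩
    have h1' : ∀ a b, a < x → b < x → (σ.symm a < σ.symm b ↔ (a, b) ∈ r) :=
      fun a b ha hb => h1 a ha b hb
    have hN := (hnext h1').2 h2
    refine ⟨⟨h1', fun a ha => ?_⟩, hN, ?_, ?_⟩
    · by_cases hay : a = y
      · subst hay
        simp [hy, hN.leftLarge]
      · rw [← hN.leftLarge_succ_iff_of_ne ha hay, ← h3 a ha]
        simp [newStarts, hay, ha.ne]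
    · simp only [newStarts, mem_filter, mem_univ, true_and, hx, false_and, false_or] at h4
      rw [Bool.eq_iff_iff, h4, decide_eq_true_iff]
    · have := h3 y hyx
      rw [hN.leftLarge_succ_self_iff] at this
      simp only [newStarts, mem_filter, mem_univ, true_and, hyx.ne, false_and, or_false, hy] at this
      cases g <;> simp_all

/-- There is no block start to glue to. The second `x` in `newStarts S x x l false` is a dummy,
inert because the glue flag is `false`. -/
lemma blockClass_end (hr : IsBlockOrder x.val h r S) (l : Bool) :
    {σ ∈ blockClass x.val r S | IsEnd σ x ∧ decide (LeftLarge σ (x.val + 1) x) = l} =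
    blockClass (x.val + 1) (insertOrder r x ∅) (newStarts S x x l false) := by
  have hx : x ∉ S := fun hx => (hr.lt_of_mem x hx).false
  ext σ
  rw [mem_filter, mem_blockClass_insertOrder hr (by simp), mem_blockClass]
  simp only [← Fin.lt_def]
  constructor
  · rintro ⟨⟨h1, h2⟩, h3, rfl⟩
    refine ⟨fun a ha b hb => h1 a b ha hb, fun b hb => by simp [h3 b hb],
      fun a ha => ?_, ?_⟩
    · simp [newStarts, ha.ne, h2 a ha, h3.leftLarge_succ_iff ha]
    · simp [newStarts, hx]
  · rintro ⟨h1, h2, h3, h4⟩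
    have hE : IsEnd σ x := fun b hb => by simp [h2 b hb]
    refine ⟨⟨fun a b ha hb => h1 a ha b hb, fun a ha => ?_⟩, hE, ?_⟩
    · rw [← hE.leftLarge_succ_iff ha, ← h3 a ha]
      simp [newStarts, ha.ne]
    · rw [Bool.eq_iff_iff, decide_eq_true_iff, ← h4]
      simp [newStarts, hx]

lemma IsNext.symm_lt_iff {σ : Equiv.Perm (Fin n)} {x y a : Fin n} (h : IsNext σ x y)
    (ha : a < x) : σ.symm a < σ.symm x ↔ σ.symm a < σ.symm y := by
  constructor
  · exact fun h1 => h1.trans h.2.1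
  · intro h1
    refine lt_of_le_of_ne (not_lt.1 fun h2 => ?_) fun he => ha.ne (σ.symm.injective he)
    exact (h.2.2 a ha h2).not_gt h1

lemma card_startsBefore_next (hr : IsBlockOrder x.val h r S) {σ : Equiv.Perm (Fin n)}
    (hσ : σ ∈ blockClass x.val r S) {y : Fin n} (hN : IsNext σ x y) :
    #(startsBefore σ x) = #{a ∈ S | (a, y) ∈ r} := by
  rw [mem_blockClass] at hσ
  congr 1
  ext a
  simp only [startsBefore, mem_filter, mem_univ, true_and]
  constructor
  · rintro ⟨h1, h2, h3⟩
    rw [hN.symm_lt_iff h1] at h2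
    have hay : a ≠ y := by rintro rfl; exact h2.false
    rw [hN.leftLarge_succ_iff_of_ne h1 hay, ← hσ.2 a h1] at h3
    exact ⟨h3, (hσ.1 a y h1 hN.1).1 h2⟩
  · rintro ⟨h1, h2⟩
    have ha : a < x := hr.lt_of_mem a h1
    have hay : a ≠ y := by rintro rfl; exact hr.irrefl _ h2
    rw [hN.symm_lt_iff ha, hN.leftLarge_succ_iff_of_ne ha hay, ← hσ.2 a ha, hσ.1 a y ha hN.1]
    exact ⟨ha, h2, h1⟩

/-- Besides the block starts after `y`, the letter `y` itself counts exactly when `x` is not glued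
to it, since its left neighbour then exceeds `x`. This yields the extra factor `p`. -/
lemma card_startsAfter_next (hr : IsBlockOrder x.val h r S) {σ : Equiv.Perm (Fin n)}
    (hσ : σ ∈ blockClass x.val r S) {y : Fin n} (hN : IsNext σ x y) :
    #(startsAfter σ x) = #{a ∈ S | (y, a) ∈ r} + if RightSmall σ x then 0 else 1 := by
  rw [mem_blockClass] at hσ
  have key : (startsAfter σ x).erase y = {a ∈ S | (y, a) ∈ r} := by
    ext a
    simp only [startsAfter, mem_filter, mem_univ, true_and, mem_erase]
    constructor
    · rintro ⟨hay, h1, h2, h3⟩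
      rw [hN.leftLarge_succ_iff_of_ne h1 hay, ← hσ.2 a h1] at h3
      refine ⟨h3, (hσ.1 y a hN.1 h1).1 ?_⟩
      exact lt_of_le_of_ne (hN.2.2 a h1 h2) fun he => hay (σ.symm.injective he).symm
    · rintro ⟨h1, h2⟩
      have ha : a < x := hr.lt_of_mem a h1
      have hay : a ≠ y := by rintro rfl; exact hr.irrefl _ h2
      rw [hN.leftLarge_succ_iff_of_ne ha hay, ← hσ.2 a ha]
      exact ⟨hay, ha, hN.2.1.trans ((hσ.1 y a hN.1 ha).2 h2), h1⟩
  have hmem : y ∈ startsAfter σ x ↔ ¬ RightSmall σ x := by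
    simp [startsAfter, hN.1, hN.2.1, hN.leftLarge_succ_self_iff]
  rw [← key]
  split_ifs with hR
  · rw [erase_eq_of_notMem (by simp [hmem, hR]), add_zero]
  · rw [card_erase_add_one (hmem.2 hR)]

lemma card_startsBefore_end (hr : IsBlockOrder x.val h r S) {σ : Equiv.Perm (Fin n)}
    (hσ : σ ∈ blockClass x.val r S) (hE : IsEnd σ x) : #(startsBefore σ x) = h := by
  rw [mem_blockClass] at hσ
  rw [← hr.card_eq]
  congr 1
  ext a
  simp only [startsBefore, mem_filter, mem_univ, true_and]
  constructor
  · rintro ⟨h1, h2, h3⟩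
    rwa [hE.leftLarge_succ_iff h1, ← hσ.2 a h1] at h3
  · intro h1
    have ha : a < x := hr.lt_of_mem a h1
    rw [hE.leftLarge_succ_iff ha, ← hσ.2 a ha]
    exact ⟨ha, lt_of_le_of_ne (not_lt.1 (hE a ha)) fun he => ha.ne (σ.symm.injective he), h1⟩

lemma card_startsAfter_end {σ : Equiv.Perm (Fin n)} (hE : IsEnd σ x) :
    #(startsAfter σ x) = 0 := by
  rw [card_eq_zero, eq_empty_iff_forall_notMem]
  intro a ha
  simp only [startsAfter, mem_filter, mem_univ, true_and] at ha
  exact hE a ha.1 ha.2.1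

end Children

lemma card_symm_lt (σ : Equiv.Perm (Fin n)) (a : Fin n) :
    #{b | σ.symm b < σ.symm a} = (σ.symm a).val := by
  rw [← Fin.card_Iio (σ.symm a)]
  refine card_bij (fun b _ => σ.symm b) ?_ ?_ ?_
  · intro b; simp
  · intro b _ c _ h; exact σ.symm.injective h
  · intro c hc
    exact ⟨σ c, by simpa using hc, by simp⟩

lemma card_blockClass_full {r : Finset (Fin n × Fin n)} (hr : IsBlockOrder n 0 r ∅) :
    #(blockClass n r ∅) = 1 := by
  have hLL : ∀ (σ : Equiv.Perm (Fin n)) a, ¬ LeftLarge σ n a := by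
    rintro σ a ⟨c, h1, _⟩
    have := c.2
    omega
  have hmem : ∀ σ : Equiv.Perm (Fin n), σ ∈ blockClass n r ∅ ↔
      ∀ a b, σ.symm a < σ.symm b ↔ (a, b) ∈ r := by
    intro σ
    simp [mem_blockClass, hLL]
  have hlt : ∀ a b, (a, b) ∈ r → #{c | (c, a) ∈ r} < #{c | (c, b) ∈ r} := by
    intro a b hab
    refine card_lt_card ((ssubset_iff_of_subset ?_).2 ⟨a, ?_, ?_⟩)
    · intro c
      simp only [mem_filter, mem_univ, true_and]
      exact fun hc => hr.trans c a b hc hab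
    · simpa using hab
    · simpa using hr.irrefl a
  have hbd : ∀ a, #{c | (c, a) ∈ r} < n := by
    intro a
    calc #{c | (c, a) ∈ r} < #(univ : Finset (Fin n)) :=
          card_lt_card ((ssubset_iff_of_subset (subset_univ _)).2
            ⟨a, mem_univ a, by simpa using hr.irrefl a⟩)
      _ = n := by simp
  let f : Fin n → Fin n := fun a => ⟨#{c | (c, a) ∈ r}, hbd a⟩
  have hf : ∀ a b, f a < f b ↔ (a, b) ∈ r := by
    intro a b
    refine ⟨fun h => ?_, fun h => hlt a b h⟩
    have hne : a ≠ b := by rintro rfl; exact h.false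
    exact (hr.total a b a.2 b.2 hne).resolve_right fun h' =>
      lt_asymm h (show f b < f a from hlt b a h')
  have hfi : Function.Injective f := by
    intro a b hab
    by_contra hne
    rcases hr.total a b a.2 b.2 hne with h | h
    · exact ((hf a b).2 h).ne hab
    · exact ((hf b a).2 h).ne' hab
  rw [card_eq_one]
  -- The position of a letter must be its rank `f` in `r`, so `f` is the inverse of the only
  -- candidate.
  refine ⟨(Equiv.ofBijective f (Finite.injective_iff_bijective.1 hfi)).symm, ?_⟩
  ext σ
  rw [hmem, mem_singleton]
  constructor
  · intro h
    rw [← Equiv.symm_bijective.injective.eq_iff, Equiv.symm_symm]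
    ext a
    rw [← card_symm_lt σ a]
    simp [h, f]
  · rintro rfl a b
    simp [hf]

end LinearSide

end PermStat

namespace PermStat

open Finset

/-! ### Summing the linear weights -/

section LinearSum

variable {n : ℕ} {R : Type*} [CommSemiring R]

lemma linWt_next (p q w y : R) {h : ℕ} {r : Finset (Fin n × Fin n)} {S : Finset (Fin n)}
    {x : Fin n} (hr : IsBlockOrder x.val h r S) {σ : Equiv.Perm (Fin n)}
    (hσ : σ ∈ blockClass x.val r S) {t : Fin n} (hN : IsNext σ x t) {l g : Bool}
    (hl : decide (LeftLarge σ (x.val + 1) x) = l) (hg : decide (RightSmall σ x) = g) :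
    linWt p q w y σ x = q ^ #{a ∈ S | (a, t) ∈ r} * p ^ #{a ∈ S | (t, a) ∈ r} *
      bif g then 1 else p * (bif l then w else if #{a ∈ S | (a, t) ∈ r} = 0 then y else 0) := by
  subst hl hg
  rw [linWt, card_startsBefore_next hr hσ hN, card_startsAfter_next hr hσ hN]
  by_cases hR : RightSmall σ x <;> by_cases hL : LeftLarge σ (x.val + 1) x
  · simp [hR, mul_comm]
  · simp [hR, mul_comm]
  · simp [hR, hL]
    ring
  · simp only [hR, hL, isLeftMax_iff hL, card_startsBefore_next hr hσ hN]
    simp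
    split_ifs <;> ring

lemma linWt_end (p q w y : R) {h : ℕ} {r : Finset (Fin n × Fin n)} {S : Finset (Fin n)}
    {x : Fin n} (hr : IsBlockOrder x.val h r S) {σ : Equiv.Perm (Fin n)}
    (hσ : σ ∈ blockClass x.val r S) (hE : IsEnd σ x) {l : Bool}
    (hl : decide (LeftLarge σ (x.val + 1) x) = l) :
    linWt p q w y σ x = q ^ h * bif l then w else if h = 0 then y else 0 := by
  subst hl
  rw [linWt, card_startsBefore_end hr hσ hE, card_startsAfter_end hE]
  by_cases hL : LeftLarge σ (x.val + 1) x
  · simp [hL, hE.not_rightSmall]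
  · simp only [hL, isLeftMax_iff hL, card_startsBefore_end hr hσ hE, hE.not_rightSmall]
    simp

/-- Only the first block start has no predecessor; its `h - 1` successors and the extra `p` give `p
^ h`. Without block starts, the place at the end supplies the term `y`. -/
lemma sum_pow_first (p y : R) {h : ℕ} {r : Finset (Fin n × Fin n)} {S : Finset (Fin n)} {m : ℕ}
    (hr : IsBlockOrder m h r S) :
    (∑ t ∈ S, p ^ #{a ∈ S | (t, a) ∈ r} * (p * if #{a ∈ S | (a, t) ∈ r} = 0 then y else 0)) +
      (if h = 0 then y else 0) = y * p ^ h := by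
  have irr : ∀ a ∈ S, ¬ (a, a) ∈ r := fun a _ => hr.irrefl a
  have tr : ∀ a ∈ S, ∀ b ∈ S, ∀ c ∈ S, (a, b) ∈ r → (b, c) ∈ r → (a, c) ∈ r :=
    fun a _ b _ c _ => hr.trans a b c
  have tot : ∀ a ∈ S, ∀ b ∈ S, a ≠ b → (a, b) ∈ r ∨ (b, a) ∈ r :=
    fun a ha b hb => hr.total a b (hr.lt_of_mem a ha) (hr.lt_of_mem b hb)
  have := sum_card_pred S (fun a b => (a, b) ∈ r) irr tr tot
    (fun i => p ^ (#S - 1 - i) * (p * if i = 0 then y else 0))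
  rw [sum_congr rfl fun t ht => by
    rw [card_succ_eq S (fun a b => (a, b) ∈ r) irr tr tot ht], this, hr.card_eq]
  rcases h with _ | h
  · simp
  · rw [sum_range_succ']
    simp [pow_succ]
    ring

/-- As on the cyclic side, the state matters only through `h`. The flags `l` and `g` move the height
to `h + l - g`: valley up, peak down, double ascent and double descent level. -/
lemma sum_blockClass (p q w y : R) (k m h : ℕ) (hm : m + k = n) (r : Finset (Fin n × Fin n))
    (S : Finset (Fin n)) (hr : IsBlockOrder m h r S) :
    ∑ σ ∈ blockClass m r S, ∏ x with m ≤ x.val, linWt p q w y σ x = linPaths p q w y k h := by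
  induction k generalizing m h r S with
  | zero =>
    obtain rfl : m = n := by omega
    have hprod : ∀ σ : Equiv.Perm (Fin m), ∏ x with m ≤ x.val, linWt p q w y σ x = 1 := by
      intro σ
      rw [filter_false_of_mem, prod_empty]
      intro x _
      have := x.2
      omega
    simp only [hprod, sum_const, linPaths]
    split_ifs with h0
    · subst h0
      obtain rfl := card_eq_zero.1 hr.card_eq
      simp [card_blockClass_full hr]
    · have : blockClass m r S = ∅ := by
        rw [eq_empty_iff_forall_notMem]
        intro σ hσ
        obtain ⟨a, ha⟩ := card_pos.1 (Nat.pos_of_ne_zero (hr.card_eq ▸ h0))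
        obtain ⟨c, h1, _⟩ := ((mem_blockClass.1 hσ).2 a a.2).1 ha
        have := c.2
        omega
      simp [this]
  | succ k ih =>
    obtain ⟨x, rfl⟩ : ∃ x : Fin n, x.val = m := ⟨⟨m, by omega⟩, rfl⟩
    have hprod : ∀ σ : Equiv.Perm (Fin n), ∏ z with x.val ≤ z.val, linWt p q w y σ z =
        linWt p q w y σ x * ∏ z with x.val + 1 ≤ z.val, linWt p q w y σ z := by
      intro σ
      rw [← prod_insert (by simp)]
      congr 1
      ext z
      simp only [mem_filter, mem_univ, true_and, mem_insert, Fin.ext_iff]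
      omega
    simp only [hprod]
    set F : Equiv.Perm (Fin n) → R := fun σ => ∏ z with x.val + 1 ≤ z.val, linWt p q w y σ z
      with hF
    have key : ∀ r' S' h', IsBlockOrder (x.val + 1) h' r' S' →
        ∑ σ ∈ blockClass (x.val + 1) r' S', F σ = linPaths p q w y k h' :=
      fun r' S' h' hr' => ih (x.val + 1) h' (by omega) r' S' hr'
    have hxS : x ∉ S := fun hx => (hr.lt_of_mem x hx).false
    have hnew : ∀ t ∈ insert x S, ∀ l g, ∀ a ∈ newStarts S x t l g, a ≤ x := by
      intro t _ l g a ha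
      simp only [newStarts, mem_filter, mem_univ, true_and] at ha
      rcases ha with ha | ha
      · exact (Fin.lt_def.2 (hr.lt_of_mem a ha.1)).le
      · exact ha.1.le
    have hnext : ∀ t ∈ S, ∀ l g,
        ∑ σ ∈ blockClass x.val r S with IsNext σ x t ∧
          decide (LeftLarge σ (x.val + 1) x) = l ∧ decide (RightSmall σ x) = g,
          linWt p q w y σ x * F σ =
        (q ^ #{a ∈ S | (a, t) ∈ r} * p ^ #{a ∈ S | (t, a) ∈ r} *
          bif g then 1 else p * (bif l then w else if #{a ∈ S | (a, t) ∈ r} = 0 then y else 0)) *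
          linPaths p q w y k (h + l.toNat - g.toNat) := by
      intro t ht l g
      have htx : t < x := hr.lt_of_mem t ht
      rw [← key _ _ _ (hr.insert (U := upSet r t) ?_ ?_ (hnew t (mem_insert_of_mem ht) l g)
        (card_newStarts hr ht l g)), ← blockClass_next hr ht, mul_sum]
      · refine sum_congr rfl fun σ hσ => ?_
        rw [mem_filter] at hσ
        rw [linWt_next p q w y hr hσ.1 hσ.2.1 hσ.2.2.1 hσ.2.2.2]
      · intro b hb
        rcases mem_upSet.1 hb with rfl | hb
        · exact htx
        · exact (hr.lt _ _ hb).2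
      · intro a ha b hab
        rw [mem_upSet] at ha ⊢
        rcases ha with rfl | ha
        · exact .inr hab
        · exact .inr (hr.trans _ _ _ ha hab)
    have hend : ∀ l,
        ∑ σ ∈ blockClass x.val r S with IsEnd σ x ∧ decide (LeftLarge σ (x.val + 1) x) = l,
          linWt p q w y σ x * F σ =
        (q ^ h * bif l then w else if h = 0 then y else 0) *
          linPaths p q w y k (h + l.toNat) := by
      intro l
      have hcard : #(newStarts S x x l false) = h + l.toNat := by
        cases l
        · rw [← hr.card_eq]
          simp [newStarts]
        · have : newStarts S x x true false = insert x S := by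
            ext a; simp [newStarts, or_comm]
          rw [this, card_insert_of_notMem hxS, hr.card_eq, Bool.toNat_true]
      rw [← key _ _ _ (hr.insert (U := ∅) (by simp) (by simp)
        (hnew x (mem_insert_self _ _) l false) hcard), ← blockClass_end hr, mul_sum]
      refine sum_congr rfl fun σ hσ => ?_
      rw [mem_filter] at hσ
      rw [linWt_end p q w y hr hσ.1 hσ.2.1 hσ.2.2]
    -- Exactly one place occurs for each `σ`: the end, or in front of a unique `t`, which lies in
    -- `S` by `IsNext.leftLarge`.
    have hsplit : ∀ σ ∈ blockClass x.val r S, linWt p q w y σ x * F σ =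
        (∑ l : Bool, if IsEnd σ x ∧ decide (LeftLarge σ (x.val + 1) x) = l
          then linWt p q w y σ x * F σ else 0) +
        ∑ t ∈ S, ∑ l : Bool, ∑ g : Bool, if IsNext σ x t ∧
          decide (LeftLarge σ (x.val + 1) x) = l ∧ decide (RightSmall σ x) = g
          then linWt p q w y σ x * F σ else 0 := by
      intro σ hσ
      simp only [ite_and, sum_ite_irrel, sum_const_zero, sum_ite_eq, mem_univ, if_true]
      rcases isEnd_or_isNext σ x with hE | ⟨t, ht⟩
      · rw [if_pos hE, sum_eq_zero, add_zero]
        intro t _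
        rw [if_neg fun h => h.not_isEnd hE]
      · have htS : t ∈ S := ((mem_blockClass.1 hσ).2 t ht.1).2 ht.leftLarge
        rw [if_neg ht.not_isEnd, zero_add, sum_eq_single_of_mem t htS, if_pos ht]
        intro b _ hb
        rw [if_neg fun h => hb (h.unique ht)]
    have hpq := sum_pow_pred_mul_pow_succ p q S (fun a b => (a, b) ∈ r)
      (fun a _ => hr.irrefl a) (fun a _ b _ c _ => hr.trans a b c)
      (fun a ha b hb => hr.total a b (hr.lt_of_mem a ha) (hr.lt_of_mem b hb))
    rw [hr.card_eq] at hpq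
    -- The powers of `q` disappear because their exponents vanish wherever `y` survives.
    have hfirst : (∑ t ∈ S, q ^ #{a ∈ S | (a, t) ∈ r} * p ^ #{a ∈ S | (t, a) ∈ r} *
        (p * if #{a ∈ S | (a, t) ∈ r} = 0 then y else 0)) +
        q ^ h * (if h = 0 then y else 0) = y * p ^ h := by
      rw [← sum_pow_first p y hr]
      congr 1
      · refine sum_congr rfl fun t _ => ?_
        split_ifs with h0
        · simp [h0]
        · simp
      · split_ifs with h0
        · simp [h0]
        · simp
    rw [sum_congr rfl hsplit, sum_add_distrib]
    have hsum1 : ∑ σ ∈ blockClass x.val r S, (∑ l : Bool,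
        if IsEnd σ x ∧ decide (LeftLarge σ (x.val + 1) x) = l
          then linWt p q w y σ x * F σ else 0) = ∑ l : Bool,
        (q ^ h * bif l then w else if h = 0 then y else 0) *
          linPaths p q w y k (h + l.toNat) := by
      rw [sum_comm]
      refine sum_congr rfl fun l _ => ?_
      rw [← sum_filter, hend]
    have hsum2 : ∑ σ ∈ blockClass x.val r S, (∑ t ∈ S, ∑ l : Bool, ∑ g : Bool,
        if IsNext σ x t ∧ decide (LeftLarge σ (x.val + 1) x) = l ∧ decide (RightSmall σ x) = g
          then linWt p q w y σ x * F σ else 0) = ∑ t ∈ S, ∑ l : Bool, ∑ g : Bool,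
        (q ^ #{a ∈ S | (a, t) ∈ r} * p ^ #{a ∈ S | (t, a) ∈ r} *
          bif g then 1 else p * (bif l then w else if #{a ∈ S | (a, t) ∈ r} = 0 then y else 0)) *
          linPaths p q w y k (h + l.toNat - g.toNat) := by
      rw [sum_comm]
      refine sum_congr rfl fun t ht => ?_
      rw [sum_comm]
      refine sum_congr rfl fun l _ => ?_
      rw [sum_comm]
      refine sum_congr rfl fun g _ => ?_
      rw [← sum_filter, hnext t ht]
    rw [hsum1, hsum2]
    -- The unglued places in front of block starts give `p [h]` and the end gives `q ^ h`, which
    -- together make the up weight `[h+1]`.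
    simp only [Fintype.sum_bool, cond_true, cond_false, Bool.toNat_true, Bool.toNat_false,
      add_zero, Nat.add_sub_cancel, Nat.sub_zero, mul_one, sum_add_distrib, ← sum_mul, hpq,
      linPaths, pqNat_succ]
    rw [← hfirst, ← hpq]
    simp only [← mul_assoc]
    ring

theorem sum_prod_linWt (p q w y : R) :
    ∑ σ : Equiv.Perm (Fin n), ∏ x, linWt p q w y σ x = linPaths p q w y n 0 := by
  rw [← sum_blockClass p q w y n 0 0 (Nat.zero_add n) ∅ ∅
    ⟨by simp, by simp, by simp, by simp, by simp, by simp⟩]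
  simp [blockClass]

end LinearSum

end PermStat

namespace PermStat

open Finset

/-! ### From positions in the word to letters -/

section Word

variable {n : ℕ}

lemma word_pos (σ : Equiv.Perm (Fin n)) (x : Fin n) :
    word σ ((σ.symm x).val + 1) = x.val + 1 := by
  simp [word]

/-- `σ.symm a` is a zero-based position, hence the one-based position of the left neighbour of `a`.
The boundary value `σ(0) = 0` is never large. -/
lemma lt_word_left_iff (σ : Equiv.Perm (Fin n)) (k : ℕ) (a : Fin n) :
    k + 1 < word σ (σ.symm a).val ↔ LeftLarge σ (k + 1) a := by
  constructor
  · intro h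
    have h0 : (σ.symm a).val ≠ 0 := by
      intro h0
      simp [word, h0] at h
    refine ⟨σ ⟨(σ.symm a).val - 1, by omega⟩, ?_, by simp; omega⟩
    rw [word, dif_pos ⟨by omega, by omega⟩] at h
    omega
  · rintro ⟨c, h1, h2⟩
    rw [← h2, word_pos]
    omega

lemma word_right_lt_iff (σ : Equiv.Perm (Fin n)) (x : Fin n) :
    word σ ((σ.symm x).val + 1 + 1) < x.val + 1 ↔ RightSmall σ x := by
  constructor
  · intro h
    have hlt : (σ.symm x).val + 1 < n := by
      by_contra hge
      rw [word, dif_neg (by omega)] at h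
      omega
    refine ⟨σ ⟨(σ.symm x).val + 1, hlt⟩, ?_, by simp⟩
    rw [word, dif_pos ⟨by omega, by omega⟩] at h
    rw [Fin.lt_def]
    simpa using h
  · rintro ⟨c, h1, h2⟩
    rw [h2, word_pos]
    exact Nat.succ_lt_succ h1

/-- The boundary letter `n + 1` exceeds every letter, so a letter at the last position counts as
having a larger right neighbour. -/
lemma lt_word_right_iff (σ : Equiv.Perm (Fin n)) (x : Fin n) :
    x.val + 1 < word σ ((σ.symm x).val + 1 + 1) ↔ ¬ RightSmall σ x := by
  rw [← word_right_lt_iff, not_lt]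
  refine ⟨le_of_lt, fun h => lt_of_le_of_ne h fun he => ?_⟩
  rw [word] at he
  split_ifs at he with h1
  · have h2 : x = σ ⟨(σ.symm x).val + 1 + 1 - 1, by omega⟩ := Fin.ext (by omega)
    rw [← Equiv.symm_apply_eq, Fin.ext_iff] at h2
    simp at h2
  · have := (σ.symm x).2
    have := x.2
    omega

lemma word_left_lt_iff (σ : Equiv.Perm (Fin n)) (x : Fin n) :
    word σ (σ.symm x).val < x.val + 1 ↔ ¬ LeftLarge σ (x.val + 1) x := by
  rw [← lt_word_left_iff, not_lt]
  refine ⟨le_of_lt, fun h => lt_of_le_of_ne h fun he => ?_⟩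
  rw [word] at he
  split_ifs at he with h1
  · have h2 : σ ⟨(σ.symm x).val - 1, by omega⟩ = x := Fin.ext (by omega)
    rw [← Equiv.eq_symm_apply, Fin.ext_iff] at h2
    simp at h2
    omega
  · have := (σ.symm x).2
    omega

lemma isValley_iff (σ : Equiv.Perm (Fin n)) (x : Fin n) :
    IsValley σ ((σ.symm x).val + 1) ↔ LeftLarge σ (x.val + 1) x ∧ ¬ RightSmall σ x := by
  rw [IsValley, word_pos, Nat.add_sub_cancel, gt_iff_lt, lt_word_left_iff, lt_word_right_iff]

lemma isDoubleAscent_iff (σ : Equiv.Perm (Fin n)) (x : Fin n) :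
    IsDoubleAscent σ ((σ.symm x).val + 1) ↔
      ¬ LeftLarge σ (x.val + 1) x ∧ ¬ RightSmall σ x := by
  rw [IsDoubleAscent, word_pos, Nat.add_sub_cancel, word_left_lt_iff, lt_word_right_iff]

/-- Positions `1, …, n` of the word of `σ` correspond to letters. -/
lemma forall_pos_iff (σ : Equiv.Perm (Fin n)) (P : ℕ → Prop) :
    (∀ i ∈ Icc 1 n, P i) ↔ ∀ x : Fin n, P ((σ.symm x).val + 1) := by
  constructor
  · intro h x
    exact h _ (by simp)
  · intro h i hi
    rw [mem_Icc] at hi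
    have := h (σ ⟨i - 1, by omega⟩)
    simpa [Nat.sub_add_cancel hi.1] using this

lemma isForemax_iff (σ : Equiv.Perm (Fin n)) (x : Fin n) :
    IsForemax σ ((σ.symm x).val + 1) ↔
      (¬ LeftLarge σ (x.val + 1) x ∧ ¬ RightSmall σ x) ∧ IsLeftMax σ x := by
  rw [IsForemax, isDoubleAscent_iff]
  refine and_congr_right fun _ => ?_
  have h1 : (∀ j ∈ Ico 1 ((σ.symm x).val + 1), word σ j < word σ ((σ.symm x).val + 1)) ↔
      ∀ j ∈ Icc 1 n, j < (σ.symm x).val + 1 → word σ j < x.val + 1 := by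
    rw [word_pos]
    constructor
    · intro h j hj hlt
      exact h j (mem_Ico.2 ⟨(mem_Icc.1 hj).1, hlt⟩)
    · intro h j hj
      rw [mem_Ico] at hj
      exact h j (mem_Icc.2 ⟨hj.1, by omega⟩) hj.2
  rw [h1, forall_pos_iff σ]
  simp only [word_pos, IsLeftMax, Fin.lt_def, Nat.add_lt_add_iff_right]

lemma card_pos_eq (σ : Equiv.Perm (Fin n)) (P : ℕ → Prop) [DecidablePred P] :
    #{i ∈ Icc 1 n | P i} = #{x : Fin n | P ((σ.symm x).val + 1)} := by
  symm
  refine card_bij (fun x _ => (σ.symm x).val + 1) ?_ ?_ ?_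
  · intro x hx
    simpa [Nat.succ_le_iff] using hx
  · intro x _ z _ h
    exact σ.symm.injective (Fin.ext (Nat.succ_injective h))
  · intro i hi
    rw [mem_filter, mem_Icc] at hi
    exact ⟨σ ⟨i - 1, by omega⟩, by simpa [Nat.sub_add_cancel hi.1.1] using hi.2,
      by simp [Nat.sub_add_cancel hi.1.1]⟩

lemma card_pos_pairs_eq (σ : Equiv.Perm (Fin n)) (P : ℕ → ℕ → Prop)
    [∀ i j, Decidable (P i j)] :
    #{ij ∈ Icc 1 n ×ˢ Icc 1 n | P ij.1 ij.2} =
      ∑ x : Fin n, #{a : Fin n | P ((σ.symm a).val + 1) ((σ.symm x).val + 1)} := by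
  rw [← card_pairs_eq_sum fun a x => P ((σ.symm a).val + 1) ((σ.symm x).val + 1)]
  symm
  refine card_bij (fun x _ => ((σ.symm x.1).val + 1, (σ.symm x.2).val + 1)) ?_ ?_ ?_
  · intro x hx
    simpa [Nat.succ_le_iff] using hx
  · rintro ⟨x, x'⟩ _ ⟨z, z'⟩ _ h
    simp only [Prod.mk.injEq, Nat.add_right_cancel_iff] at h
    exact Prod.ext (σ.symm.injective (Fin.ext h.1)) (σ.symm.injective (Fin.ext h.2))
  · rintro ⟨i, j⟩ hi
    simp only [mem_filter, mem_product, mem_Icc] at hi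
    exact ⟨(σ ⟨i - 1, by omega⟩, σ ⟨j - 1, by omega⟩),
      by simpa [Nat.sub_add_cancel hi.1.1.1, Nat.sub_add_cancel hi.1.2.1] using hi.2,
      by simp [Nat.sub_add_cancel hi.1.1.1, Nat.sub_add_cancel hi.1.2.1]⟩

lemma pat31_2_eq_sum (σ : Equiv.Perm (Fin n)) :
    pat31_2 σ = ∑ x, #(startsBefore σ x) := by
  rw [pat31_2, card_pos_pairs_eq σ fun i j => (2 ≤ i ∧ i < j) ∧
    word σ (i - 1) > word σ j ∧ word σ j > word σ i]
  refine sum_congr rfl fun x _ => ?_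
  congr 1
  ext a
  simp only [startsBefore, mem_filter, mem_univ, true_and, word_pos, Nat.add_sub_cancel,
    gt_iff_lt, lt_word_left_iff, Fin.lt_def]
  constructor
  · rintro ⟨⟨h1, h2⟩, h3, h4⟩
    exact ⟨by omega, by omega, h3⟩
  · rintro ⟨h1, h2, h3⟩
    obtain ⟨c, _, hc⟩ := id h3
    exact ⟨⟨by omega, by omega⟩, h3, by omega⟩

lemma pat2_31_eq_sum (σ : Equiv.Perm (Fin n)) :
    pat2_31 σ = ∑ x, #(startsAfter σ x) := by
  have h0 : pat2_31 σ = #{ij ∈ Icc 1 n ×ˢ Icc 1 n |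
      ij.2 < ij.1 ∧ word σ ij.1 < word σ ij.2 ∧ word σ ij.2 < word σ (ij.1 - 1)} := by
    rw [pat2_31]
    -- Pairs are indexed by the positions of the `1` and of the `2`, so that the `3` becomes a left
    -- neighbour, as in `startsAfter`.
    refine card_bij (fun ij _ => (ij.2 + 1, ij.1)) ?_ ?_ ?_
    · rintro ⟨i, j⟩ h
      simp only [mem_filter, mem_product, mem_Icc] at h ⊢
      refine ⟨⟨⟨by omega, by omega⟩, h.1.1⟩, by omega, h.2.2⟩
    · rintro ⟨i, j⟩ _ ⟨i', j'⟩ _ h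
      simp only [Prod.mk.injEq] at h ⊢
      omega
    · rintro ⟨j, i⟩ h
      simp only [mem_filter, mem_product, mem_Icc] at h
      obtain ⟨⟨⟨h1, h2⟩, h3, h4⟩, h5, h6, h7⟩ := h
      have hne : i ≠ j - 1 := by
        rintro rfl
        exact h7.false
      refine ⟨(i, j - 1), ?_, by simp; omega⟩
      simp only [mem_filter, mem_product, mem_Icc, Nat.sub_add_cancel h1]
      exact ⟨⟨⟨h3, h4⟩, by omega, by omega⟩, ⟨by omega, by omega⟩, h6, h7⟩
  rw [h0, card_pos_pairs_eq σ fun i j => j < i ∧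
    word σ i < word σ j ∧ word σ j < word σ (i - 1)]
  refine sum_congr rfl fun x _ => ?_
  congr 1
  ext a
  simp only [startsAfter, mem_filter, mem_univ, true_and, word_pos, Nat.add_sub_cancel,
    lt_word_left_iff, Fin.lt_def, Nat.add_lt_add_iff_right]
  tauto

lemma valley_eq (σ : Equiv.Perm (Fin n)) :
    valley σ = #{x : Fin n | LeftLarge σ (x.val + 1) x ∧ ¬ RightSmall σ x} := by
  simp only [valley, card_pos_eq σ, isValley_iff]

lemma da_eq (σ : Equiv.Perm (Fin n)) :
    da σ = #{x : Fin n | ¬ LeftLarge σ (x.val + 1) x ∧ ¬ RightSmall σ x} := by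
  simp only [da, card_pos_eq σ, isDoubleAscent_iff]

/-- Every double ascent is a foremaximum. -/
def AllForemax (σ : Equiv.Perm (Fin n)) : Prop :=
  ∀ i ∈ {i ∈ Icc 1 n | IsDoubleAscent σ i}, IsForemax σ i

instance : DecidablePred (AllForemax (n := n)) :=
  fun σ => by unfold AllForemax; infer_instance

lemma allForemax_iff (σ : Equiv.Perm (Fin n)) : AllForemax σ ↔
    ∀ x : Fin n, ¬ LeftLarge σ (x.val + 1) x ∧ ¬ RightSmall σ x → IsLeftMax σ x := by
  simp only [AllForemax, mem_filter, and_imp]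
  rw [forall_pos_iff σ]
  simp only [isDoubleAscent_iff, isForemax_iff]
  grind

/-- A double ascent that is not a left-to-right maximum contributes a factor 0, which kills exactly
the permutations outside `AllForemax`. -/
lemma prod_linWt {R : Type*} [CommSemiring R] (p q w y : R) (σ : Equiv.Perm (Fin n)) :
    ∏ x, linWt p q w y σ x = if AllForemax σ then
      p ^ pat2_31 σ * q ^ pat31_2 σ * w ^ valley σ * y ^ da σ else 0 := by
  split_ifs with hF
  · rw [allForemax_iff] at hF
    have h1 : ∀ x, linWt p q w y σ x = p ^ #(startsAfter σ x) * q ^ #(startsBefore σ x) *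
        (if LeftLarge σ (x.val + 1) x ∧ ¬ RightSmall σ x then w else 1) *
        (if ¬ LeftLarge σ (x.val + 1) x ∧ ¬ RightSmall σ x then y else 1) := by
      intro x
      rw [linWt]
      congr 1
      split_ifs with h1 h2 <;> simp_all
    simp only [h1, prod_mul_distrib, prod_pow_eq_pow_sum, prod_ite, prod_const, one_pow, mul_one,
      pat2_31_eq_sum, pat31_2_eq_sum, valley_eq, da_eq]
  · rw [allForemax_iff] at hF
    push Not at hF
    obtain ⟨x, h1, h2⟩ := hF
    refine prod_eq_zero (mem_univ x) ?_
    rw [linWt, if_pos h1, if_neg h2, mul_zero]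

end Word

end PermStat

namespace PermStat

open Finset

/-! ### Extraction of coefficients -/

section Coefficients

open Polynomial

lemma coeff_coeff_sum {ι R : Type*} [CommSemiring R] (s : Finset ι) (f : ι → R) (a c : ι → ℕ)
    (k j : ℕ) :
    ((∑ i ∈ s, (C (C (f i)) * C X ^ a i * X ^ c i : R[X][X])).coeff j).coeff k =
      ∑ i ∈ s with a i = k ∧ c i = j, f i := by
  rw [sum_filter]
  simp only [finsetSum_coeff]
  refine sum_congr rfl fun i _ => ?_
  rw [← C_pow, ← C_mul, coeff_C_mul, coeff_X_pow]
  by_cases hj : c i = j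
  · subst hj
    by_cases hk : a i = k
    · simp [hk]
    · simp [hk, coeff_X_pow, Ne.symm hk]
  · simp [hj, Ne.symm hj]

lemma b_eq_sum_S (n k j : ℕ) :
    b n k j = ∑ σ ∈ S n k j, pVar ^ nest σ * qVar ^ cros σ := by
  have h : S n k j = {σ ∈ (univ : Finset (Equiv.Perm (Fin n))).filter (fun σ => cda σ = 0) |
      cvalley σ = k ∧ fix σ = j} := by
    ext σ
    simp only [S, mem_filter, mem_univ, true_and]
    tauto
  rw [h, ← coeff_coeff_sum, b, B, sum_filter]
  refine congrArg (fun P : (MvPolynomial (Fin 2) ℤ)[X][X] => (P.coeff j).coeff k) ?_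
  refine sum_congr rfl fun σ _ => ?_
  -- Setting `u = 0` leaves the indicator of `cda σ = 0`, because `0 ^ 0 = 1`.
  split_ifs with h0 <;> simp [h0]

lemma b_eq_sum_SStar (n k j : ℕ) :
    b n k j = ∑ σ ∈ SStar n k j, pVar ^ pat2_31 σ * qVar ^ pat31_2 σ := by
  have h : SStar n k j = {σ ∈ (univ : Finset (Equiv.Perm (Fin n))).filter AllForemax |
      valley σ = k ∧ da σ = j} := by
    ext σ
    simp only [SStar, mem_filter, mem_univ, true_and, AllForemax]
    tauto
  rw [h, ← coeff_coeff_sum, b, sum_filter]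
  refine congrArg (fun P : (MvPolynomial (Fin 2) ℤ)[X][X] => (P.coeff j).coeff k) ?_
  rw [B_eq_cycPaths, cycPaths_zero_eq_linPaths_zero, ← sum_prod_linWt]
  refine sum_congr rfl fun σ _ => ?_
  rw [prod_linWt]
  simp

lemma S_zero_eq_D (n k : ℕ) : S n k 0 = D n k := by
  ext σ
  simp only [S, D, fix, mem_filter, mem_univ, true_and, card_eq_zero, filter_eq_empty_iff,
    forall_const]
  tauto

/-- Without double ascents the foremaximum condition is vacuous and there are no foremaxima. -/
lemma SStar_zero_eq_DStar (n k : ℕ) : SStar n k 0 = DStar n k := by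
  ext σ
  have hda : da σ = 0 ↔ ∀ i ∈ Icc 1 n, ¬ IsDoubleAscent σ i := by
    rw [da, card_eq_zero, filter_eq_empty_iff]
  have hfmax : fmax σ = 0 ↔ ∀ i ∈ Icc 1 n, ¬ IsForemax σ i := by
    rw [fmax, card_eq_zero, filter_eq_empty_iff]
  simp only [SStar, DStar, mem_filter, mem_univ, true_and, hda, hfmax]
  constructor
  · rintro ⟨h1, h2, -⟩
    exact ⟨fun i hi h => h2 i hi h.1, h1, h2⟩
  · rintro ⟨-, h1, h2⟩
    exact ⟨h1, h2, fun i hi => absurd hi.2 (h2 i hi.1)⟩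

end Coefficients

end PermStat

theorem mainTheorem10 (n k : ℕ) :
    (∀ j : ℕ,
      PermStat.b n k j =
          ∑ σ ∈ PermStat.S n k j,
            PermStat.pVar ^ PermStat.nest σ * PermStat.qVar ^ PermStat.cros σ ∧
        PermStat.b n k j =
          ∑ σ ∈ PermStat.SStar n k j,
            PermStat.pVar ^ PermStat.pat2_31 σ * PermStat.qVar ^ PermStat.pat31_2 σ) ∧
      PermStat.b n k 0 =
          ∑ σ ∈ PermStat.D n k,
            PermStat.pVar ^ PermStat.nest σ * PermStat.qVar ^ PermStat.cros σ ∧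
      PermStat.b n k 0 =
          ∑ σ ∈ PermStat.DStar n k,
            PermStat.pVar ^ PermStat.pat2_31 σ * PermStat.qVar ^ PermStat.pat31_2 σ := by
  refine ⟨fun j => ⟨PermStat.b_eq_sum_S n k j, PermStat.b_eq_sum_SStar n k j⟩, ?_, ?_⟩
  · rw [← PermStat.S_zero_eq_D, PermStat.b_eq_sum_S]
  · rw [← PermStat.SStar_zero_eq_DStar, PermStat.b_eq_sum_SStar]
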